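/- Let $\mathbb{N}^*=\{1,2,\dots\}$ and, for $x>0$, let $\lfloor x\rfloor$ denote the largest integer strictly smaller than $x$. For $D\subset\mathbb{R}^t$, $\alpha>0$ and $B>0$, let $\mathcal{H}^{\alpha}(D,B)$ be the set of functions $f:D\to\mathbb{R}$ whose partial derivatives up to order $\lfloor\alpha\rfloor$ exist and are continuous on $D$, with $\sup_{D}|\partial^{\boldsymbol\beta}f|\le B$ for all multi-indices $|\boldsymbol\beta|\le\lfloor\alpha\rfloor$ and $|\partial^{\boldsymbol\beta}f(x)-\partial^{\boldsymbol\beta}f(y)|\le B\|x-y\|_2^{\alpha-\lfloor\alpha\rfloor}$ for all $|\boldsymbol\beta|=\lfloor\alpha\rfloor$ and $x,y\in D$. For $k\in\mathbb{N}^*$, $\mathbf{d}=(d_0,\dots,d_k)\in(\mathbb{N}^*)^{k+1}$, $d_{k+1}=1$, $\mathbf{t}=(t_0,\dots,t_k)\in(\mathbb{N}^*)^{k+1}$ with $t_i\le d_i$, and $\boldsymbol\alpha=(\alpha_0,\dots,\alpha_k)\in(0,\infty)^{k+1}$, let $\mathcal{F}(k,\mathbf{d},\mathbf{t},\boldsymbol\alpha,B)$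 be the set of all compositions $f_k\circ\cdots\circ f_0$, where $f_i=(f_{ij})_{1\le j\le d_{i+1}}:[a_i,b_i]^{d_i}\to[a_{i+1},b_{i+1}]^{d_{i+1}}$ for some reals $a_i<b_i$ with $|a_i|\vee|b_i|\le B$, $a_0=0$, $b_0=1$, and each $f_{ij}$ depends on only $t_i$ of its coordinates and, as a function of these, belongs to $\mathcal{H}^{\alpha_i}([a_i,b_i]^{t_i},B)$. Let $\sigma>0$ and let $P_W$ be the uniform distribution on $[0,1]^{d_0}$. For a measurable $f:[0,1]^{d_0}\to\mathbb{R}$ write $Q_f(w)=\mathcal{N}(f(w),\sigma^2)$, and put $\ell(Q_f,Q_g)=\int\|Q_f(w)-Q_g(w)\|_{TV}\,dP_W(w)$, where $\|P-R\|_{TV}=\sup_A[P(A)-R(A)]$. Set $\alpha_i^*=\alpha_i\prod_{l=i+1}^{k}(\alpha_l\wedge1)$ and $\phi_n=\max_{0\le i\le k}n^{-\alpha_i^*/(2\alpha_i^*+t_i)}$. Theorem. For all $k,\mathbf{d},\mathbf{t},\boldsymbol\alpha$ as above such that $t_j\le\min(d_0,\dots,d_{j-1})$ for all $j\ge1$,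 there is $B_0>0$ such that for every $B\ge B_0$ and every $\sigma>0$ there is a constant $c>0$ such that for all $n\ge1$ $$\inf_{\widehat f}\ \sup_{f^\star\in\mathcal{F}(k,\mathbf{d},\mathbf{t},\boldsymbol\alpha,B)}\mathbb{E}\big[\ell(Q_{f^\star},Q_{\widehat f})\big]\ \ge\ c\,\phi_n ,$$ where the expectation is over $n$ i.i.d. observations $(W_i,Y_i)$ with $W_i\sim P_W$ and $Y_i\mid W_i\sim\mathcal{N}(f^\star(W_i),\sigma^2)$, and the infimum runs over all estimators $\widehat f$, i.e. all maps from the observations to measurable functions $[0,1]^{d_0}\to\mathbb{R}$ such that $\ell(Q_g,Q_{\widehat f})$ is a measurable function of the observations for every measurable $g:[0,1]^{d_0}\to\mathbb{R}$. -/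

import Mathlib

open MeasureTheory ProbabilityTheory
open scoped NNReal ENNReal

namespace CompositeRegression

noncomputable section

/-- The cube `[a, b]^t` in the Euclidean space `ℝ^t`. -/
def cube (t : ℕ) (a b : ℝ) : Set (EuclideanSpace ℝ (Fin t)) :=
  {x | ∀ j, x j ∈ Set.Icc a b}

/-- The largest integer *strictly smaller* than `α` (for `α > 0`), so that `strictFloor 1 = 0`. -/
def strictFloor (α : ℝ) : ℕ := ⌈α⌉₊ - 1

/-- The mixed partial derivative `∂_{J 0} ⋯ ∂_{J (m-1)} g (x)` of order `m`, relative to the domain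
`D` (one-sided at boundary points of `D`). As `J` ranges over all maps `Fin m → Fin t`, these are
the derivatives `∂^β g` for all multi-indices `β` with `|β| = m`. -/
def mixedPartial {t m : ℕ} (g : EuclideanSpace ℝ (Fin t) → ℝ) (D : Set (EuclideanSpace ℝ (Fin t)))
    (J : Fin m → Fin t) (x : EuclideanSpace ℝ (Fin t)) : ℝ :=
  iteratedFDerivWithin ℝ m g D x (fun r => EuclideanSpace.single (J r) (1 : ℝ))

/-- The Hölder ball `H^α(D, B)`: all partial derivatives of order at most `⌊α⌋` exist, are continuous
and are bounded by `B` on `D`, and those of order `⌊α⌋` are `(α - ⌊α⌋)`-Hölder on `D` with constant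
`B`, where `⌊α⌋` is the largest integer strictly smaller than `α`. Only the values of
`g` on `D` matter. -/
def HolderBall {t : ℕ} (α B : ℝ) (D : Set (EuclideanSpace ℝ (Fin t))) :
    Set (EuclideanSpace ℝ (Fin t) → ℝ) :=
  {g | ContDiffOn ℝ (strictFloor α : ℕ) g D ∧
    (∀ m : ℕ, m ≤ strictFloor α → ∀ J : Fin m → Fin t, ∀ x ∈ D, |mixedPartial g D J x| ≤ B) ∧
    (∀ J : Fin (strictFloor α) → Fin t, ∀ x ∈ D, ∀ y ∈ D, x ≠ y →
      |mixedPartial g D J x - mixedPartial g D J y| / ‖x - y‖ ^ (α - (strictFloor α : ℝ)) ≤ B)}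

/-- The covariate space `[0, 1]^{d₀}`. -/
abbrev Covariate (d₀ : ℕ) : Type := ↥(cube d₀ 0 1)

/-- The uniform distribution on `[0, 1]^{d₀}` (Lebesgue measure restricted to the unit cube). -/
def uniformCube (d₀ : ℕ) : Measure (Covariate d₀) :=
  (volume : Measure (EuclideanSpace ℝ (Fin d₀))).comap Subtype.val

/-- The measurable real functions on `[0, 1]^{d₀}`. -/
abbrev RegFun (d₀ : ℕ) : Type := {f : Covariate d₀ → ℝ // Measurable f}

/-- For layers `f i : ℝ^{d i} → ℝ^{d (i + 1)}`, `i = 0, …, k`, the partial composition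
`f (i - 1) ∘ ⋯ ∘ f 0 : ℝ^{d 0} → ℝ^{d i}`, for `i = 0, …, k + 1`. -/
def composeLayers {k : ℕ} (d : Fin (k + 2) → ℕ)
    (f : ∀ i : Fin (k + 1),
      EuclideanSpace ℝ (Fin (d i.castSucc)) → EuclideanSpace ℝ (Fin (d i.succ))) :
    ∀ i : Fin (k + 2), EuclideanSpace ℝ (Fin (d 0)) → EuclideanSpace ℝ (Fin (d i)) :=
  Fin.induction (motive := fun i => EuclideanSpace ℝ (Fin (d 0)) → EuclideanSpace ℝ (Fin (d i)))
    id (fun i g => f i ∘ g)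

/-- The class `F(k, d, t, α, B)` of compositions `f k ∘ ⋯ ∘ f 0` on `[0, 1]^{d 0}` (used with
`d (k + 1) = 1`). Layer `f i` maps `[a i, b i]^{d i}` to `[a (i+1), b (i+1)]^{d (i+1)}`, where
`a 0 = 0`, `b 0 = 1` and `|a i|, |b i| ≤ B`, and each of its components depends on `t i` of the
coordinates only, as a function of which it lies in `H^{α i}([a i, b i]^{t i}, B)`. -/
def compositeClass (k : ℕ) (d : Fin (k + 2) → ℕ) (t : Fin (k + 1) → ℕ) (α : Fin (k + 1) → ℝ)
    (B : ℝ) : Set (RegFun (d 0)) :=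
  {F | ∃ (a b : Fin (k + 2) → ℝ)
      (f : ∀ i : Fin (k + 1),
        EuclideanSpace ℝ (Fin (d i.castSucc)) → EuclideanSpace ℝ (Fin (d i.succ))),
    a 0 = 0 ∧ b 0 = 1 ∧
    (∀ i, a i < b i ∧ |a i| ≤ B ∧ |b i| ≤ B) ∧
    (∀ i, Set.MapsTo (f i) (cube (d i.castSucc) (a i.castSucc) (b i.castSucc))
      (cube (d i.succ) (a i.succ) (b i.succ))) ∧
    (∀ i, ∀ j : Fin (d i.succ), ∃ s : Fin (t i) ↪ Fin (d i.castSucc),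
      ∃ g ∈ HolderBall (α i) B (cube (t i) (a i.castSucc) (b i.castSucc)),
        ∀ x ∈ cube (d i.castSucc) (a i.castSucc) (b i.castSucc),
          f i x j = g (WithLp.toLp 2 (fun r => x (s r)))) ∧
    ∀ w : Covariate (d 0), ∀ j : Fin (d (Fin.last (k + 1))),
      F.1 w = composeLayers d f (Fin.last (k + 1)) w.1 j}

/-- The Gaussian conditional distribution `Q_f`: given `w`, the law `N(f(w), σ²)`. -/
def gaussianCond {d₀ : ℕ} (σ : ℝ≥0) (f : RegFun d₀) : Kernel (Covariate d₀) ℝ where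
  toFun w := gaussianReal (f.1 w) (σ ^ 2)
  measurable' := measurable_gaussianReal.comp (f.2.prodMk measurable_const)

/-- The total variation distance `sup_A [P A - R A]` of two probability measures. -/
def tvDist {Ω : Type*} [MeasurableSpace Ω] (P R : Measure Ω) : ℝ≥0∞ :=
  ⨆ (A : Set Ω) (_ : MeasurableSet A), (P A - R A)

/-- The loss `ℓ(Q, Q') = ∫ ‖Q(w) - Q'(w)‖_TV dP_W(w)` for `P_W` uniform on `[0, 1]^{d₀}`. -/
def ellLoss {d₀ : ℕ} (Q Q' : Kernel (Covariate d₀) ℝ) : ℝ≥0∞ :=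
  ∫⁻ w, tvDist (Q w) (Q' w) ∂(uniformCube d₀)

/-- The law of the sample `(W_1, Y_1), …, (W_n, Y_n)`: independent pairs with `W_i` uniform on
`[0, 1]^{d₀}` and `Y_i` given `W_i` distributed as `N(f(W_i), σ²)`. -/
def sampleLaw {d₀ : ℕ} (σ : ℝ≥0) (n : ℕ) (f : RegFun d₀) :
    Measure (Fin n → Covariate d₀ × ℝ) :=
  Measure.pi (fun _ => uniformCube d₀ ⊗ₘ gaussianCond σ f)

/-- An estimator of the regression function from `n` observations: a map from samples to
measurable functions whose loss is a measurable function of the sample. -/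
def IsEstimator {d₀ : ℕ} (σ : ℝ≥0) (n : ℕ)
    (fhat : (Fin n → Covariate d₀ × ℝ) → RegFun d₀) : Prop :=
  ∀ g : RegFun d₀, Measurable (fun x => ellLoss (gaussianCond σ g) (gaussianCond σ (fhat x)))

/-- The minimax risk `inf_fhat sup_{f ∈ F} E_f[ℓ(Q_f, Q_fhat)]` over a class `F`. -/
def minimaxRisk {d₀ : ℕ} (σ : ℝ≥0) (n : ℕ) (F : Set (RegFun d₀)) : ℝ≥0∞ :=
  ⨅ (fhat : (Fin n → Covariate d₀ × ℝ) → RegFun d₀) (_ : IsEstimator σ n fhat),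
    ⨆ f ∈ F, ∫⁻ x, ellLoss (gaussianCond σ f) (gaussianCond σ (fhat x)) ∂(sampleLaw σ n f)

/-- The effective smoothness `α*_i = α_i ∏_{l = i+1}^k min(α_l, 1)`. -/
def effSmooth {k : ℕ} (α : Fin (k + 1) → ℝ) (i : Fin (k + 1)) : ℝ :=
  α i * ∏ l ∈ Finset.Ioi i, min (α l) 1

/-- The rate `φ_n = max_i n^{-α*_i / (2 α*_i + t_i)}`. -/
def rate {k : ℕ} (t : Fin (k + 1) → ℕ) (α : Fin (k + 1) → ℝ) (n : ℕ) : ℝ :=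
  Finset.univ.sup' Finset.univ_nonempty
    (fun i => (n : ℝ) ^ (-(effSmooth α i / (2 * effSmooth α i + (t i : ℝ)))))

end

/-! `P_W` and `Q_f` are probability measures, so the joint law `uniformCube d₀ ⊗ₘ gaussianCond σ f`
above is the genuine one. -/

instance isMarkovKernel_gaussianCond {d₀ : ℕ} (σ : ℝ≥0) (f : RegFun d₀) :
    IsMarkovKernel (gaussianCond σ f) where
  isProbabilityMeasure w := by
    change IsProbabilityMeasure (gaussianReal (f.1 w) (σ ^ 2))
    infer_instance

theorem measurableSet_cube (t : ℕ) (a b : ℝ) : MeasurableSet (cube t a b) := by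
  have : cube t a b = ⋂ j, {x : EuclideanSpace ℝ (Fin t) | x j ∈ Set.Icc a b} := by
    ext x; simp [cube]
  rw [this]
  exact MeasurableSet.iInter fun j =>
    (measurableSet_Icc.preimage (by fun_prop : Measurable fun x : EuclideanSpace ℝ (Fin t) => x j))

instance isProbabilityMeasure_uniformCube (d₀ : ℕ) : IsProbabilityMeasure (uniformCube d₀) where
  measure_univ := by
    have h1 : uniformCube d₀ Set.univ = volume (cube d₀ 0 1) := by
      rw [uniformCube, comap_subtype_coe_apply (measurableSet_cube d₀ 0 1)]
      simp
    have h2 : cube d₀ 0 1 =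
        (WithLp.ofLp : EuclideanSpace ℝ (Fin d₀) → Fin d₀ → ℝ) ⁻¹'
          (Set.univ.pi fun _ => Set.Icc (0 : ℝ) 1) := by
      ext x
      simp only [cube, Set.mem_ofPred_eq, Set.mem_preimage, Set.mem_univ_pi]
    rw [h1, h2, (PiLp.volume_preserving_ofLp (Fin d₀)).measure_preimage
      (MeasurableSet.univ_pi fun _ => measurableSet_Icc).nullMeasurableSet, volume_pi_pi]
    simp

end CompositeRegression

namespace CompositeRegression

/-! ### Chi-square domination -/

/-! Since `rate` is a maximum over finitely many layers, it suffices to bound the risk below by the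
rate of one layer `i`, and this is done by Assouad's method. Cut `[0,1]^{t_i}` into `m^{t_i}` cells
and switch on or off, cell by cell, a bump of height `m^{-α_i}`; these sums lie in a Hölder ball
whose radius does not depend on `m` (`bumpSum_mem_holderBall`). The layers before `i` transmit the
first `t_i` coordinates, which is where `t_i ≤ d_l` for `l ≤ i` is used. The layers after `i` apply
`x ↦ x^{min(α_l,1)}`, whose singularity at `0` amplifies the bumps to height `Δ = m^{-α_i^*}`. All
intermediate cubes are `[0,1]`.

Flipping one bit changes the regression function by at most `Δ`, on a set of measure `m^{-t_i}`. The
second moment of the likelihood ratio of one observation is thus at most `1 + C m^{-(2α_i^*+t_i)}`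
(`chiSqDom_bumpFun`), and for `n` observations it stays below `exp C` once `m` is of order
`n^{1/(2α_i^*+t_i)}` (`exists_mesh`). So no bit can be tested reliably.

Each wrong bit costs a multiple of `Δ m^{-t_i}` in loss: on a fixed fraction of the cell the two
functions differ by exactly `Δ`, and for means at distance at most `1` the total variation of the
Gaussians is at least a multiple of that distance (`sum_le_ellLoss_bumpFun`). Over `m^{t_i}` bits,
`assouad` yields a multiple of `Δ`, which is the rate of layer `i`. -/

theorem sq_lintegral_mul_le {Ω : Type*} [MeasurableSpace Ω] (μ : Measure Ω) {f g : Ω → ℝ≥0∞}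
    (hf : AEMeasurable f μ) (hg : AEMeasurable g μ) :
    (∫⁻ x, f x * g x ∂μ) ^ 2 ≤ (∫⁻ x, f x ^ 2 ∂μ) * ∫⁻ x, g x ^ 2 ∂μ := by
  have h := ENNReal.lintegral_mul_le_Lp_mul_Lq μ Real.HolderConjugate.two_two hf hg
  calc (∫⁻ x, f x * g x ∂μ) ^ 2
      ≤ ((∫⁻ x, f x ^ (2 : ℝ) ∂μ) ^ (1 / 2 : ℝ) * (∫⁻ x, g x ^ (2 : ℝ) ∂μ) ^ (1 / 2 : ℝ)) ^ 2 := by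
        gcongr
        exact h
    _ = _ := by
        rw [mul_pow, ← ENNReal.rpow_natCast, ← ENNReal.rpow_mul, ← ENNReal.rpow_natCast,
          ← ENNReal.rpow_mul]
        norm_num

/-- `ν` is dominated by `μ` with second moment of the likelihood ratio at most `R`, expressed by
the equivalent Cauchy–Schwarz inequality. -/
def ChiSqDom {Ω : Type*} [MeasurableSpace Ω] (μ ν : Measure Ω) (R : ℝ≥0∞) : Prop :=
  ∀ f : Ω → ℝ≥0∞, Measurable f → (∫⁻ x, f x ∂ν) ^ 2 ≤ R * ∫⁻ x, f x ^ 2 ∂μ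

theorem ennreal_le_sqrt {x y : ℝ≥0∞} (h : x ^ 2 ≤ y) : x ≤ y ^ (1 / 2 : ℝ) := by
  have h2 := ENNReal.rpow_le_rpow h (by norm_num : (0 : ℝ) ≤ 1 / 2)
  rwa [← ENNReal.rpow_natCast, ← ENNReal.rpow_mul, show ((2 : ℕ) : ℝ) * (1 / 2) = 1 by norm_num,
    ENNReal.rpow_one] at h2

theorem ennreal_sqrt_sq (y : ℝ≥0∞) : (y ^ (1 / 2 : ℝ)) ^ 2 = y := by
  rw [← ENNReal.rpow_natCast, ← ENNReal.rpow_mul]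
  norm_num

theorem ChiSqDom.mono {Ω : Type*} [MeasurableSpace Ω] {μ ν : Measure Ω} {R R' : ℝ≥0∞}
    (h : ChiSqDom μ ν R) (hR : R ≤ R') : ChiSqDom μ ν R' := fun f hf =>
  (h f hf).trans (by gcongr)

/-- The Cauchy–Schwarz form makes tensorization an iterated application: first on the fibres, then
on the base to the square root of the fibrewise second moment. No densities are needed. -/
theorem ChiSqDom.prod {Ω Ω' : Type*} [MeasurableSpace Ω] [MeasurableSpace Ω'] {μ ν : Measure Ω}
    {μ' ν' : Measure Ω'} [SFinite μ] [SFinite ν] [SFinite μ'] [SFinite ν'] {R R' : ℝ≥0∞}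
    (h : ChiSqDom μ ν R) (h' : ChiSqDom μ' ν' R') :
    ChiSqDom (μ.prod μ') (ν.prod ν') (R * R') := by
  intro f hf
  have hm : Measurable fun x => ∫⁻ y, f (x, y) ^ 2 ∂μ' :=
    (hf.pow_const 2).lintegral_prod_right'
  rw [lintegral_prod _ hf.aemeasurable, lintegral_prod _ (hf.pow_const 2).aemeasurable]
  calc (∫⁻ x, ∫⁻ y, f (x, y) ∂ν' ∂ν) ^ 2
      ≤ (∫⁻ x, (R' * ∫⁻ y, f (x, y) ^ 2 ∂μ') ^ (1 / 2 : ℝ) ∂ν) ^ 2 := by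
        gcongr with x
        exact ennreal_le_sqrt (h' (fun y => f (x, y)) (hf.comp measurable_prodMk_left))
    _ ≤ R * ∫⁻ x, ((R' * ∫⁻ y, f (x, y) ^ 2 ∂μ') ^ (1 / 2 : ℝ)) ^ 2 ∂μ :=
        h _ ((hm.const_mul R').pow_const _)
    _ = R * R' * ∫⁻ x, ∫⁻ y, f (x, y) ^ 2 ∂μ' ∂μ := by
        simp_rw [ennreal_sqrt_sq]
        rw [lintegral_const_mul _ hm, mul_assoc]

/-- Both laws share the first marginal `μ`, so after the fibrewise bound a plain Cauchy–Schwarz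
inequality under `μ` averages the second moments `R w`. -/
theorem ChiSqDom.compProd {Ω Ω' : Type*} [MeasurableSpace Ω] [MeasurableSpace Ω'] {μ : Measure Ω}
    [SFinite μ] {κ η : Kernel Ω Ω'} [IsSFiniteKernel κ] [IsSFiniteKernel η] {R : Ω → ℝ≥0∞}
    (hR : Measurable R) (h : ∀ w, ChiSqDom (κ w) (η w) (R w)) :
    ChiSqDom (μ ⊗ₘ κ) (μ ⊗ₘ η) (∫⁻ w, R w ∂μ) := by
  intro f hf
  have hm : Measurable fun x => ∫⁻ y, f (x, y) ^ 2 ∂(κ x) :=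
    (hf.pow_const 2).lintegral_kernel_prod_right'
  rw [Measure.lintegral_compProd hf, Measure.lintegral_compProd (hf.pow_const 2)]
  calc (∫⁻ x, ∫⁻ y, f (x, y) ∂(η x) ∂μ) ^ 2
      ≤ (∫⁻ x, (R x) ^ (1 / 2 : ℝ) * (∫⁻ y, f (x, y) ^ 2 ∂(κ x)) ^ (1 / 2 : ℝ) ∂μ) ^ 2 := by
        gcongr with x
        rw [← ENNReal.mul_rpow_of_nonneg _ _ (by norm_num)]
        exact ennreal_le_sqrt (h x (fun y => f (x, y)) (hf.comp measurable_prodMk_left))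
    _ ≤ (∫⁻ x, ((R x) ^ (1 / 2 : ℝ)) ^ 2 ∂μ) *
          ∫⁻ x, ((∫⁻ y, f (x, y) ^ 2 ∂(κ x)) ^ (1 / 2 : ℝ)) ^ 2 ∂μ :=
        sq_lintegral_mul_le μ (hR.pow_const _).aemeasurable (hm.pow_const _).aemeasurable
    _ = _ := by simp_rw [ennreal_sqrt_sq]

theorem ChiSqDom.of_measurePreserving {Ω Ω' : Type*} [MeasurableSpace Ω] [MeasurableSpace Ω']
    {μ ν : Measure Ω} {μ' ν' : Measure Ω'} {R : ℝ≥0∞} (e : Ω → Ω')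
    (hμ : MeasurePreserving e μ μ') (hν : MeasurePreserving e ν ν') (h : ChiSqDom μ ν R) :
    ChiSqDom μ' ν' R := by
  intro f hf
  rw [← hν.lintegral_comp hf, ← hμ.lintegral_comp (hf.pow_const 2)]
  exact h _ (hf.comp hμ.measurable)

theorem ChiSqDom.pi {Ω : Type*} [MeasurableSpace Ω] {μ ν : Measure Ω} [SigmaFinite μ]
    [SigmaFinite ν] {R : ℝ≥0∞} (h : ChiSqDom μ ν R) (n : ℕ) :
    ChiSqDom (Measure.pi fun _ : Fin n => μ) (Measure.pi fun _ : Fin n => ν) (R ^ n) := by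
  induction n with
  | zero =>
    intro f hf
    simp [Measure.pi_of_empty _ (fun i : Fin 0 => i.elim0), lintegral_dirac]
  | succ n ih =>
    rw [pow_succ']
    exact (h.prod ih).of_measurePreserving _
      ((measurePreserving_piFinSuccAbove (fun _ : Fin (n + 1) => μ) 0).symm)
      ((measurePreserving_piFinSuccAbove (fun _ : Fin (n + 1) => ν) 0).symm)

/-- Under chi-square domination, the two error probabilities of a test cannot both be small. -/
theorem ChiSqDom.test_error {Ω : Type*} [MeasurableSpace Ω] {μ ν : Measure Ω}
    [IsProbabilityMeasure ν] {R : ℝ} (hR : 1 ≤ R) (h : ChiSqDom μ ν (ENNReal.ofReal R)) {A : Set Ω}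
    (hA : MeasurableSet A) : ENNReal.ofReal (1 / (4 * R)) ≤ μ A + ν Aᶜ := by
  have hR0 : 0 < R := by linarith
  -- If `ν A ≥ 1/2`, domination applied to the indicator of `A` gives `1/4 ≤ R * μ A`; otherwise `ν
  -- Aᶜ ≥ 1/2` already suffices, as `R ≥ 1`.
  rcases le_total (1 / 2 : ℝ≥0∞) (ν A) with hx | hx
  · refine le_trans ?_ le_self_add
    have h1 := h (A.indicator fun _ => 1) (measurable_const.indicator hA)
    have h2 : ∀ x, (A.indicator (fun _ => (1 : ℝ≥0∞)) x) ^ 2 = A.indicator (fun _ => 1) x := by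
      intro x
      by_cases hx : x ∈ A <;> simp [hx]
    simp_rw [h2] at h1
    rw [lintegral_indicator_const hA, lintegral_indicator_const hA, one_mul, one_mul] at h1
    have h3 : (1 / 2 : ℝ≥0∞) ^ 2 ≤ ENNReal.ofReal R * μ A := le_trans (by gcongr) h1
    rw [mul_comm] at h3
    have h4 := ENNReal.div_le_of_le_mul h3
    refine le_trans (le_of_eq ?_) h4
    rw [show (1 / 2 : ℝ≥0∞) ^ 2 = ENNReal.ofReal ((1 / 2) ^ 2) by
      rw [ENNReal.ofReal_pow (by norm_num), ENNReal.ofReal_div_of_pos (by norm_num)]; simp,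
      ← ENNReal.ofReal_div_of_pos hR0]
    congr 1
    field_simp
    norm_num
  · refine le_trans ?_ le_add_self
    rw [prob_compl_eq_one_sub hA]
    calc ENNReal.ofReal (1 / (4 * R)) ≤ ENNReal.ofReal (1 / 2) := by
          apply ENNReal.ofReal_le_ofReal
          rw [div_le_div_iff₀ (by positivity) (by norm_num)]
          linarith
      _ = 1 - 1 / 2 := by
          rw [ENNReal.ofReal_div_of_pos (by norm_num)]; simp
      _ ≤ _ := by gcongr

/-! ### Likelihood ratios of Gaussians with equal variance -/

/-- Completing the square: `p_b² / p_a` is the constant `exp ((a - b)² / v)` times the Gaussian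
density centred at the reflected mean `2b - a`. Its integral is therefore that constant. -/
theorem gaussianPDF_mul_gaussianPDF (a b : ℝ) {v : ℝ≥0} (x : ℝ) :
    gaussianPDF b v x * gaussianPDF b v x =
      ENNReal.ofReal (Real.exp ((a - b) ^ 2 / v)) *
        (gaussianPDF (2 * b - a) v x * gaussianPDF a v x) := by
  unfold gaussianPDF
  rw [← ENNReal.ofReal_mul (gaussianPDFReal_nonneg _ _ _),
    ← ENNReal.ofReal_mul (gaussianPDFReal_nonneg _ _ _), ← ENNReal.ofReal_mul (by positivity)]
  congr 1
  unfold gaussianPDFReal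
  set C := (√(2 * Real.pi * v))⁻¹
  rw [show C * Real.exp (-(x - b) ^ 2 / (2 * v)) * (C * Real.exp (-(x - b) ^ 2 / (2 * v))) =
    C * C * (Real.exp (-(x - b) ^ 2 / (2 * v)) * Real.exp (-(x - b) ^ 2 / (2 * v))) by ring,
    show Real.exp ((a - b) ^ 2 / v) * (C * Real.exp (-(x - (2 * b - a)) ^ 2 / (2 * v)) *
      (C * Real.exp (-(x - a) ^ 2 / (2 * v)))) = C * C * (Real.exp ((a - b) ^ 2 / v) *
      (Real.exp (-(x - (2 * b - a)) ^ 2 / (2 * v)) * Real.exp (-(x - a) ^ 2 / (2 * v)))) by ring,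
    ← Real.exp_add, ← Real.exp_add, ← Real.exp_add]
  congr 2
  by_cases hv : (v : ℝ) = 0
  · simp [hv]
  · field_simp
    ring

theorem lintegral_gaussianReal (a : ℝ) {v : ℝ≥0} (hv : v ≠ 0) {f : ℝ → ℝ≥0∞} (hf : Measurable f) :
    ∫⁻ x, f x ∂(gaussianReal a v) = ∫⁻ x, gaussianPDF a v x * f x := by
  rw [gaussianReal_of_var_ne_zero _ hv,
    lintegral_withDensity_eq_lintegral_mul _ (measurable_gaussianPDF a v) hf]
  rfl

theorem chiSqDom_gaussianReal (a b : ℝ) {v : ℝ≥0} (hv : v ≠ 0) :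
    ChiSqDom (gaussianReal a v) (gaussianReal b v)
      (ENNReal.ofReal (Real.exp ((a - b) ^ 2 / v))) := by
  intro f hf
  have hpa := measurable_gaussianPDF a v
  have hpb := measurable_gaussianPDF b v
  have hpc := measurable_gaussianPDF (2 * b - a) v
  set E := ENNReal.ofReal (Real.exp ((a - b) ^ 2 / v))
  rw [lintegral_gaussianReal b hv hf, lintegral_gaussianReal a hv (hf.pow_const 2)]
  have key : ∀ x, gaussianPDF b v x * f x =
      (E * gaussianPDF (2 * b - a) v x) ^ (1 / 2 : ℝ) *
        (gaussianPDF a v x * f x ^ 2) ^ (1 / 2 : ℝ) := by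
    intro x
    rw [← ENNReal.mul_rpow_of_nonneg _ _ (by norm_num),
      show E * gaussianPDF (2 * b - a) v x * (gaussianPDF a v x * f x ^ 2) =
        (E * (gaussianPDF (2 * b - a) v x * gaussianPDF a v x)) * f x ^ 2 by ring,
      ← gaussianPDF_mul_gaussianPDF a b x,
      show gaussianPDF b v x * gaussianPDF b v x * f x ^ 2 = (gaussianPDF b v x * f x) ^ 2 by ring,
      ← ENNReal.rpow_natCast, ← ENNReal.rpow_mul]
    norm_num
  simp_rw [key]
  refine (sq_lintegral_mul_le volume
    ((hpc.const_mul E).pow_const _).aemeasurable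
    ((hpa.mul (hf.pow_const 2)).pow_const _).aemeasurable).trans ?_
  simp_rw [ennreal_sqrt_sq]
  rw [lintegral_const_mul _ hpc, lintegral_gaussianPDF_eq_one _ hv, mul_one]
  exact le_rfl

/-! ### Total variation distance and the loss -/

theorem tvDist_le_swap {Ω : Type*} [MeasurableSpace Ω] (P R : Measure Ω) [IsProbabilityMeasure P]
    [IsProbabilityMeasure R] : tvDist P R ≤ tvDist R P := by
  refine iSup₂_le fun A hA => ?_
  refine le_trans ?_ (le_iSup₂ (f := fun A (_ : MeasurableSet A) => R A - P A) Aᶜ hA.compl)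
  rw [prob_compl_eq_one_sub hA, prob_compl_eq_one_sub hA, tsub_tsub, tsub_le_iff_right]
  have hR : 1 = (1 - R A) + R A := (tsub_add_cancel_of_le prob_le_one).symm
  -- Subtraction in `ℝ≥0∞` is truncated, so the case `P A ≤ R A`, where the left-hand difference is
  -- `0`, is separated.
  rcases le_total (P A) (R A) with h | h
  · exact h.trans le_add_self
  · have h1 : 1 - (R A + (1 - P A)) + (R A + (1 - P A)) = 1 := by
      apply tsub_add_cancel_of_le
      calc R A + (1 - P A) ≤ P A + (1 - P A) := by gcongr
        _ = 1 := add_tsub_cancel_of_le prob_le_one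
    have h2 : (1 - (R A + (1 - P A)) + R A) + (1 - P A) = P A + (1 - P A) := by
      rw [add_assoc, h1, add_tsub_cancel_of_le prob_le_one]
    exact ((ENNReal.add_left_inj (by simp)).1 h2).ge

theorem tvDist_comm {Ω : Type*} [MeasurableSpace Ω] (P R : Measure Ω) [IsProbabilityMeasure P]
    [IsProbabilityMeasure R] : tvDist P R = tvDist R P :=
  le_antisymm (tvDist_le_swap P R) (tvDist_le_swap R P)

theorem tvDist_triangle {Ω : Type*} [MeasurableSpace Ω] (P Q R : Measure Ω) :
    tvDist P R ≤ tvDist P Q + tvDist Q R := by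
  refine iSup₂_le fun A hA => (tsub_le_tsub_add_tsub (b := Q A)).trans (add_le_add ?_ ?_)
  · exact le_iSup₂ (f := fun A (_ : MeasurableSet A) => P A - Q A) A hA
  · exact le_iSup₂ (f := fun A (_ : MeasurableSet A) => Q A - R A) A hA

/-- The supremum is attained at `{q ≤ p}`. The integral formula serves to make the distance
measurable in the covariate, which a supremum over uncountably many events does not show. -/
theorem tvDist_withDensity {Ω : Type*} [MeasurableSpace Ω] {μ : Measure Ω} {p q : Ω → ℝ≥0∞}
    (hp : Measurable p) (hq : Measurable q) (hqf : ∫⁻ x, q x ∂μ ≠ ∞) :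
    tvDist (μ.withDensity p) (μ.withDensity q) = ∫⁻ x, (p x - q x) ∂μ := by
  apply le_antisymm
  · refine iSup₂_le fun A hA => ?_
    rw [withDensity_apply _ hA, withDensity_apply _ hA, tsub_le_iff_left]
    calc ∫⁻ x in A, p x ∂μ ≤ ∫⁻ x in A, (q x + (p x - q x)) ∂μ :=
          lintegral_mono fun x => le_add_tsub
      _ = ∫⁻ x in A, q x ∂μ + ∫⁻ x in A, (p x - q x) ∂μ := lintegral_add_left hq _
      _ ≤ _ := by
          gcongr
          exact Measure.restrict_le_self
  · have hA : MeasurableSet {x | q x ≤ p x} := measurableSet_le hq hp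
    refine le_trans ?_ (le_iSup₂ (f := fun A (_ : MeasurableSet A) =>
      μ.withDensity p A - μ.withDensity q A) _ hA)
    rw [withDensity_apply _ hA, withDensity_apply _ hA, ← lintegral_sub hq
      (ne_top_of_le_ne_top hqf (setLIntegral_le_lintegral _ _))
      ((ae_restrict_iff' hA).2 (Filter.Eventually.of_forall fun x hx => hx)),
      ← lintegral_indicator hA]
    refine lintegral_mono fun x => ?_
    by_cases hx : q x ≤ p x
    · simp [Set.indicator_of_mem (s := {x | q x ≤ p x}) hx]
    · simp [tsub_eq_zero_of_le (not_le.1 hx).le]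

theorem tvDist_gaussianReal (a b : ℝ) {v : ℝ≥0} (hv : v ≠ 0) :
    tvDist (gaussianReal a v) (gaussianReal b v) =
      ∫⁻ x, (gaussianPDF a v x - gaussianPDF b v x) := by
  rw [gaussianReal_of_var_ne_zero _ hv, gaussianReal_of_var_ne_zero _ hv]
  exact tvDist_withDensity (measurable_gaussianPDF a v) (measurable_gaussianPDF b v)
    (by rw [lintegral_gaussianPDF_eq_one _ hv]; simp)

theorem measurable_tvDist_gaussianCond {d₀ : ℕ} {σ : ℝ≥0} (hσ : 0 < σ) (f g : RegFun d₀) :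
    Measurable fun w => tvDist (gaussianCond σ f w) (gaussianCond σ g w) := by
  have hv : σ ^ 2 ≠ 0 := by positivity
  have h : ∀ w, tvDist (gaussianCond σ f w) (gaussianCond σ g w) =
      ∫⁻ x, (gaussianPDF (f.1 w) (σ ^ 2) x - gaussianPDF (g.1 w) (σ ^ 2) x) :=
    fun w => tvDist_gaussianReal _ _ hv
  simp_rw [h]
  have hpdf : ∀ f : RegFun d₀,
      Measurable fun z : Covariate d₀ × ℝ => gaussianPDF (f.1 z.1) (σ ^ 2) z.2 := fun f =>
    measurable_uncurry_gaussianPDF.comp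
      ((f.2.comp measurable_fst).prodMk (measurable_const.prodMk measurable_snd))
  exact ((hpdf f).sub (hpdf g)).lintegral_prod_right'

theorem ellLoss_comm {d₀ : ℕ} (σ : ℝ≥0) (f g : RegFun d₀) :
    ellLoss (gaussianCond σ f) (gaussianCond σ g) = ellLoss (gaussianCond σ g) (gaussianCond σ f) :=
  lintegral_congr fun _ => tvDist_comm _ _

theorem ellLoss_triangle {d₀ : ℕ} {σ : ℝ≥0} (hσ : 0 < σ) (f g h : RegFun d₀) :
    ellLoss (gaussianCond σ f) (gaussianCond σ h) ≤
      ellLoss (gaussianCond σ f) (gaussianCond σ g) +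
        ellLoss (gaussianCond σ g) (gaussianCond σ h) := by
  unfold ellLoss
  rw [← lintegral_add_left (measurable_tvDist_gaussianCond hσ f g)]
  exact lintegral_mono fun w => tvDist_triangle _ _ _

theorem le_tvDist_gaussianReal_of_le {a b : ℝ} {v : ℝ≥0} (hv : v ≠ 0) (hab : a ≤ b)
    (hab1 : b ≤ a + 1) :
    ENNReal.ofReal (gaussianPDFReal 0 v 1 * (b - a)) ≤
      tvDist (gaussianReal a v) (gaussianReal b v) := by
  -- Test with the half-line below the smaller mean: by translation the difference of masses is the
  -- mass under `N(a, v)` of an interval of length `b - a ≤ 1` ending at `a`, where the density is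
  -- at least its value at distance `1` from the mean.
  refine le_trans ?_ (le_iSup₂ (f := fun A (_ : MeasurableSet A) =>
    gaussianReal a v A - gaussianReal b v A) (Set.Iic a) measurableSet_Iic)
  have h1 : gaussianReal b v (Set.Iic a) = gaussianReal a v (Set.Iic (2 * a - b)) := by
    rw [show b = a + (b - a) by ring, ← gaussianReal_map_add_const (b - a),
      Measure.map_apply (by fun_prop) measurableSet_Iic]
    congr 1
    ext x
    simp only [Set.mem_preimage, Set.mem_Iic]
    constructor <;> intro h <;> linarith
  have h2 : gaussianReal a v (Set.Iic a) =
      gaussianReal a v (Set.Iic (2 * a - b)) + gaussianReal a v (Set.Ioc (2 * a - b) a) := by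
    rw [← measure_union (Set.Iic_disjoint_Ioc le_rfl) measurableSet_Ioc,
      Set.Iic_union_Ioc_eq_Iic (by linarith)]
  rw [h1, h2, ENNReal.add_sub_cancel_left (measure_ne_top _ _), gaussianReal_apply _ hv]
  calc ENNReal.ofReal (gaussianPDFReal 0 v 1 * (b - a))
      = ∫⁻ _ in Set.Ioc (2 * a - b) a, ENNReal.ofReal (gaussianPDFReal 0 v 1) := by
        rw [setLIntegral_const, Real.volume_Ioc, show a - (2 * a - b) = b - a by ring,
          ENNReal.ofReal_mul (gaussianPDFReal_nonneg _ _ _)]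
    _ ≤ ∫⁻ x in Set.Ioc (2 * a - b) a, gaussianPDF a v x := by
        refine setLIntegral_mono (measurable_gaussianPDF a v) fun x hx => ?_
        apply ENNReal.ofReal_le_ofReal
        unfold gaussianPDFReal
        gcongr ?_ * Real.exp (-?_ / _)
        have := hx.1
        have := hx.2
        nlinarith

theorem le_tvDist_gaussianReal {a b : ℝ} {v : ℝ≥0} (hv : v ≠ 0) (hab : |a - b| ≤ 1) :
    ENNReal.ofReal (gaussianPDFReal 0 v 1 * |a - b|) ≤
      tvDist (gaussianReal a v) (gaussianReal b v) := by
  rcases le_total a b with h | h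
  · rw [abs_of_nonpos (by linarith)] at hab ⊢
    rw [neg_sub]
    exact le_tvDist_gaussianReal_of_le hv h (by linarith)
  · rw [abs_of_nonneg (by linarith)] at hab ⊢
    rw [tvDist_comm]
    exact le_tvDist_gaussianReal_of_le hv h (by linarith)

/-! ### Assouad's lemma -/

/-- Candidates are compared one at a time. Measurability of the minimal loss is carried through the
induction because the next comparison set needs it. -/
theorem exists_measurable_argmin {Ω κ : Type*} [MeasurableSpace Ω] [MeasurableSpace κ]
    [Nonempty κ] (L : κ → Ω → ℝ≥0∞) (hL : ∀ θ, Measurable (L θ)) (s : Finset κ) :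
    ∃ T : Ω → κ, Measurable T ∧ Measurable (fun x => L (T x) x) ∧
      ∀ x, ∀ θ ∈ s, L (T x) x ≤ L θ x := by
  classical
  induction s using Finset.induction_on with
  | empty =>
    obtain ⟨θ⟩ := ‹Nonempty κ›
    exact ⟨fun _ => θ, measurable_const, hL θ, by simp⟩
  | insert θ s _ ih =>
    obtain ⟨T, hT, hLT, hmin⟩ := ih
    have hs : MeasurableSet {x | L θ x ≤ L (T x) x} := measurableSet_le (hL θ) hLT
    refine ⟨fun x => if L θ x ≤ L (T x) x then θ else T x, Measurable.ite hs measurable_const hT,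
      ?_, fun x η hη => ?_⟩
    · have : (fun x => L (if L θ x ≤ L (T x) x then θ else T x) x) =
          fun x => if L θ x ≤ L (T x) x then L θ x else L (T x) x := by
        ext x
        split_ifs <;> rfl
      rw [this]
      exact Measurable.ite hs (hL θ) hLT
    · dsimp only
      rcases Finset.mem_insert.1 hη with rfl | hη
      · split_ifs with h
        · exact le_rfl
        · exact (not_le.1 h).le
      · split_ifs with h
        · exact h.trans (hmin x η hη)
        · exact hmin x η hη

/-- Changing one sign of a vertex of the hypercube. -/
def flipAt {ι : Type*} [DecidableEq ι] (u : ι) (θ : ι → Bool) : ι → Bool :=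
  Function.update θ u (!θ u)

theorem flipAt_involutive {ι : Type*} [DecidableEq ι] (u : ι) :
    Function.Involutive (flipAt u) := fun θ => by
  simp [flipAt]

/-- Flipping a bit permutes the vertices, so summing the two-point bound over all of them counts
every `a θ` twice. -/
theorem card_mul_le_two_mul_sum {ι : Type*} [Fintype ι] [DecidableEq ι] (u : ι)
    (a : (ι → Bool) → ℝ≥0∞) {c : ℝ≥0∞} (h : ∀ θ, c ≤ a θ + a (flipAt u θ)) :
    (Fintype.card (ι → Bool) : ℝ≥0∞) * c ≤ 2 * ∑ θ, a θ := by
  have h1 : ∑ θ, a (flipAt u θ) = ∑ θ, a θ :=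
    Equiv.sum_comp (flipAt_involutive u).toPerm a
  calc (Fintype.card (ι → Bool) : ℝ≥0∞) * c = ∑ _θ : ι → Bool, c := by simp
    _ ≤ ∑ θ, (a θ + a (flipAt u θ)) := Finset.sum_le_sum fun θ _ => h θ
    _ = _ := by rw [Finset.sum_add_distrib, h1, two_mul]

instance isProbabilityMeasure_sampleLaw {d₀ : ℕ} (σ : ℝ≥0) (n : ℕ) (f : RegFun d₀) :
    IsProbabilityMeasure (sampleLaw σ n f) := by
  unfold sampleLaw
  infer_instance

/-- The estimate is replaced by a nearest vertex `T`, at the cost of a factor `2` by the triangle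
inequality. The separation then bounds `δ` times the number of wrong bits, and each bit is a test
between neighbouring vertices. Pairing the neighbours costs the other factor `2` in the final `4`.
-/
theorem assouad {d₀ : ℕ} {σ : ℝ≥0} (hσ : 0 < σ) (n : ℕ) {F : Set (RegFun d₀)}
    {ι : Type*} [Fintype ι] [DecidableEq ι] (f : (ι → Bool) → RegFun d₀) (hF : ∀ θ, f θ ∈ F)
    {δ : ℝ≥0∞} (hsep : ∀ θ η : ι → Bool, ∑ u, (if θ u ≠ η u then δ else 0) ≤
      ellLoss (gaussianCond σ (f θ)) (gaussianCond σ (f η)))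
    {R : ℝ} (hR : 1 ≤ R) (hχ : ∀ θ u, ChiSqDom (sampleLaw σ n (f θ))
      (sampleLaw σ n (f (flipAt u θ))) (ENNReal.ofReal R)) :
    ENNReal.ofReal (1 / (4 * R)) * (Fintype.card ι * δ) / 4 ≤ minimaxRisk σ n F := by
  classical
  refine le_iInf₂ fun fhat hest => ?_
  rw [ENNReal.div_le_iff_le_mul (by simp) (by simp), mul_comm _ (4 : ℝ≥0∞)]
  set L : (ι → Bool) → (Fin n → Covariate d₀ × ℝ) → ℝ≥0∞ :=
    fun θ x => ellLoss (gaussianCond σ (f θ)) (gaussianCond σ (fhat x)) with hLdef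
  set S := ⨆ g ∈ F, ∫⁻ x, ellLoss (gaussianCond σ g) (gaussianCond σ (fhat x)) ∂(sampleLaw σ n g)
  obtain ⟨T, hT, -, hmin⟩ := exists_measurable_argmin L (fun θ => hest (f θ)) Finset.univ
  have hTu : ∀ u b, MeasurableSet {x | T x u = b} := fun u b =>
    ((measurable_pi_apply u).comp hT) (measurableSet_singleton b)
  have hTn : ∀ u b, MeasurableSet {x | b ≠ T x u} := fun u b => by
    convert (hTu u b).compl using 1
    ext x
    simp [eq_comm]
  have hrisk : ∀ θ, ∑ u, δ * sampleLaw σ n (f θ) {x | θ u ≠ T x u} ≤ 2 * S := by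
    intro θ
    have h1 : ∀ x, ∑ u, {x | θ u ≠ T x u}.indicator (fun _ => δ) x ≤ 2 * L θ x := by
      intro x
      calc ∑ u, {x | θ u ≠ T x u}.indicator (fun _ => δ) x
          = ∑ u, (if θ u ≠ T x u then δ else 0) := by
            refine Finset.sum_congr rfl fun u _ => ?_
            simp [Set.indicator_apply]
        _ ≤ L θ x + ellLoss (gaussianCond σ (fhat x)) (gaussianCond σ (f (T x))) :=
            (hsep θ (T x)).trans (ellLoss_triangle hσ _ _ _)
        _ ≤ 2 * L θ x := by
            rw [two_mul, ellLoss_comm]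
            gcongr
            exact hmin x θ (Finset.mem_univ _)
    calc ∑ u, δ * sampleLaw σ n (f θ) {x | θ u ≠ T x u}
        = ∫⁻ x, ∑ u, {x | θ u ≠ T x u}.indicator (fun _ => δ) x ∂(sampleLaw σ n (f θ)) := by
          rw [lintegral_finsetSum _ fun u _ => measurable_const.indicator (hTn u _)]
          refine Finset.sum_congr rfl fun u _ => ?_
          rw [lintegral_indicator_const (hTn u _)]
      _ ≤ ∫⁻ x, 2 * L θ x ∂(sampleLaw σ n (f θ)) := lintegral_mono h1
      _ = 2 * ∫⁻ x, L θ x ∂(sampleLaw σ n (f θ)) := lintegral_const_mul _ (hest _)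
      _ ≤ 2 * S := by
          gcongr
          exact le_iSup₂ (f := fun g (_ : g ∈ F) =>
            ∫⁻ x, ellLoss (gaussianCond σ g) (gaussianCond σ (fhat x)) ∂(sampleLaw σ n g))
            (f θ) (hF θ)
  have htest : ∀ u θ, ENNReal.ofReal (1 / (4 * R)) ≤ sampleLaw σ n (f θ) {x | θ u ≠ T x u} +
      sampleLaw σ n (f (flipAt u θ)) {x | flipAt u θ u ≠ T x u} := by
    intro u θ
    -- Bits being Boolean, the complement of an error at `θ` is an error at the flipped vertex.
    refine ((hχ θ u).test_error hR (hTn u (θ u))).trans (le_of_eq ?_)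
    congr 2
    ext x
    simp only [flipAt, Set.mem_compl_iff, Set.mem_ofPred_eq, Function.update_self]
    cases θ u <;> cases T x u <;> simp
  have hC0 : (Fintype.card (ι → Bool) : ℝ≥0∞) ≠ 0 := by
    exact_mod_cast Fintype.card_ne_zero
  -- The supremum risk is bounded below by the average over the hypercube; multiplying by the number
  -- of vertices turns averages into sums.
  refine (ENNReal.mul_le_mul_iff_right hC0 (by simp)).1 ?_
  calc (Fintype.card (ι → Bool) : ℝ≥0∞) *
        (ENNReal.ofReal (1 / (4 * R)) * (Fintype.card ι * δ))
      = ∑ _u : ι, δ * (Fintype.card (ι → Bool) * ENNReal.ofReal (1 / (4 * R))) := by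
        rw [Finset.sum_const, Finset.card_univ, nsmul_eq_mul]
        ring
    _ ≤ ∑ u : ι, δ * (2 * ∑ θ, sampleLaw σ n (f θ) {x | θ u ≠ T x u}) := by
        refine Finset.sum_le_sum fun u _ => mul_le_mul_right ?_ δ
        exact card_mul_le_two_mul_sum u (fun θ => sampleLaw σ n (f θ) {x | θ u ≠ T x u}) (htest u)
    _ = 2 * ∑ θ, ∑ u, δ * sampleLaw σ n (f θ) {x | θ u ≠ T x u} := by
        rw [Finset.sum_comm, Finset.mul_sum]
        refine Finset.sum_congr rfl fun u _ => ?_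
        rw [← Finset.mul_sum]
        ring
    _ ≤ 2 * ∑ _θ : ι → Bool, 2 * S := by
        gcongr with θ
        exact hrisk θ
    _ = _ := by
        rw [Finset.sum_const, Finset.card_univ, nsmul_eq_mul]
        ring

/-! ### Elements of Hölder balls -/

theorem convex_cube (t : ℕ) (a b : ℝ) : Convex ℝ (cube t a b) := by
  intro x hx y hy p q hp hq hpq j
  exact (convex_Icc a b) (hx j) (hy j) hp hq hpq

theorem interior_cube_nonempty (t : ℕ) {a b : ℝ} (hab : a < b) :
    (interior (cube t a b)).Nonempty := by
  have ho : IsOpen {x : EuclideanSpace ℝ (Fin t) | ∀ j, x j ∈ Set.Ioo a b} := by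
    simp only [Set.ofPred_forall]
    exact isOpen_iInter_of_finite fun j => isOpen_Ioo.preimage (by fun_prop)
  refine ⟨WithLp.toLp 2 fun _ => (a + b) / 2, interior_maximal
    (fun x hx j => ⟨(hx j).1.le, (hx j).2.le⟩) ho fun j => ⟨?_, ?_⟩⟩
  · simp only
    linarith
  · simp only
    linarith

theorem uniqueDiffOn_cube (t : ℕ) {a b : ℝ} (hab : a < b) : UniqueDiffOn ℝ (cube t a b) :=
  uniqueDiffOn_convex (convex_cube t a b) (interior_cube_nonempty t hab)

theorem mixedPartial_cube {t m : ℕ} {g : EuclideanSpace ℝ (Fin t) → ℝ} (hg : ContDiff ℝ m g)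
    {a b : ℝ} (hab : a < b) (J : Fin m → Fin t) {x : EuclideanSpace ℝ (Fin t)}
    (hx : x ∈ cube t a b) :
    mixedPartial g (cube t a b) J x =
      iteratedFDeriv ℝ m g x (fun r => EuclideanSpace.single (J r) (1 : ℝ)) := by
  rw [mixedPartial, iteratedFDerivWithin_eq_iteratedFDeriv (uniqueDiffOn_cube t hab)
    hg.contDiffAt hx]

theorem mixedPartial_zero {t : ℕ} (g : EuclideanSpace ℝ (Fin t) → ℝ)
    (D : Set (EuclideanSpace ℝ (Fin t))) (J : Fin 0 → Fin t) (x : EuclideanSpace ℝ (Fin t)) :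
    mixedPartial g D J x = g x := by
  simp [mixedPartial]

theorem strictFloor_of_le_one {α : ℝ} (hα1 : α ≤ 1) : strictFloor α = 0 := by
  have : ⌈α⌉₊ ≤ 1 := Nat.ceil_le.2 (by simpa using hα1)
  unfold strictFloor
  omega

theorem strictFloor_pos_of_one_lt {α : ℝ} (hα1 : 1 < α) : 0 < strictFloor α := by
  have : 1 < ⌈α⌉₊ := Nat.lt_ceil.2 (by simpa using hα1)
  unfold strictFloor
  omega

theorem strictFloor_lt {α : ℝ} (hα : 0 < α) : (strictFloor α : ℝ) < α := by
  have h1 : 0 < ⌈α⌉₊ := Nat.ceil_pos.2 hα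
  exact Nat.lt_ceil.1 (by unfold strictFloor; omega)

theorem le_strictFloor_add_one (α : ℝ) : α ≤ strictFloor α + 1 := by
  have h2 : ⌈α⌉₊ ≤ strictFloor α + 1 := by unfold strictFloor; omega
  calc α ≤ (⌈α⌉₊ : ℝ) := Nat.le_ceil α
    _ ≤ ((strictFloor α + 1 : ℕ) : ℝ) := by exact_mod_cast h2
    _ = _ := by push_cast; ring

theorem mem_holderBall_of_le_one {t : ℕ} {α B : ℝ} (hα1 : α ≤ 1)
    {D : Set (EuclideanSpace ℝ (Fin t))} {g : EuclideanSpace ℝ (Fin t) → ℝ}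
    (hc : ContinuousOn g D) (hb : ∀ x ∈ D, |g x| ≤ B)
    (hh : ∀ x ∈ D, ∀ y ∈ D, |g x - g y| ≤ B * ‖x - y‖ ^ α) : g ∈ HolderBall α B D := by
  have h0 := strictFloor_of_le_one hα1
  unfold HolderBall
  rw [h0]
  refine ⟨by simpa [contDiffOn_zero] using hc, ?_, ?_⟩
  · intro m hm J x hx
    obtain rfl : m = 0 := by omega
    rw [mixedPartial_zero]
    exact hb x hx
  · intro J x hx y hy hxy
    have hn : 0 < ‖x - y‖ := norm_pos_iff.2 (sub_ne_zero.2 hxy)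
    rw [mixedPartial_zero, mixedPartial_zero, div_le_iff₀ (by positivity)]
    simpa using hh x hx y hy

theorem abs_rpow_sub_rpow_le {p x y : ℝ} (hp : 0 ≤ p) (hp1 : p ≤ 1) (hx : 0 ≤ x) (hy : 0 ≤ y) :
    |x ^ p - y ^ p| ≤ |x - y| ^ p := by
  wlog h : y ≤ x generalizing x y
  · rw [abs_sub_comm, abs_sub_comm x y]
    exact this hy hx (le_of_not_ge h)
  · have h1 := Real.rpow_add_le_add_rpow hy (sub_nonneg.2 h) hp hp1
    rw [add_sub_cancel] at h1
    rw [abs_of_nonneg (sub_nonneg.2 (Real.rpow_le_rpow hy h hp)), abs_of_nonneg (sub_nonneg.2 h)]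
    linarith

theorem abs_coord_sub_le {t : ℕ} (x y : EuclideanSpace ℝ (Fin t)) (r : Fin t) :
    |x r - y r| ≤ ‖x - y‖ := by
  simpa using PiLp.norm_apply_le (x - y) r

/-- The second exponent `β ≥ α` covers both uses: `β = α` for the amplifying powers and `β = 1` for
projections. Differences of coordinates in the unit cube are at most `1`, so lowering the exponent
only enlarges them. -/
theorem coord_rpow_mem_holderBall {t : ℕ} {α β B : ℝ} (hα : 0 < α) (hα1 : α ≤ 1) (hαβ : α ≤ β)
    (hβ1 : β ≤ 1) (hB : 1 ≤ B) (r : Fin t) :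
    (fun x : EuclideanSpace ℝ (Fin t) => x r ^ β) ∈ HolderBall α B (cube t 0 1) := by
  have hβ : 0 < β := hα.trans_le hαβ
  have h01 : ∀ x ∈ cube t 0 1, 0 ≤ x r ^ β ∧ x r ^ β ≤ 1 := fun x hx =>
    ⟨Real.rpow_nonneg (hx r).1 _, Real.rpow_le_one (hx r).1 (hx r).2 hβ.le⟩
  refine mem_holderBall_of_le_one hα1 ?_ ?_ ?_
  · exact ((by fun_prop : Continuous fun x : EuclideanSpace ℝ (Fin t) => x r).rpow_const
      fun _ => Or.inr hβ.le).continuousOn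
  · intro x hx
    rw [abs_of_nonneg (h01 x hx).1]
    exact (h01 x hx).2.trans hB
  · intro x hx y hy
    have hle : |x r - y r| ≤ 1 := by
      rw [abs_le]
      constructor <;> linarith [(hx r).1, (hx r).2, (hy r).1, (hy r).2]
    calc |x r ^ β - y r ^ β| ≤ |x r - y r| ^ β :=
          abs_rpow_sub_rpow_le hβ.le hβ1 (hx r).1 (hy r).1
      _ ≤ |x r - y r| ^ α := Real.rpow_le_rpow_of_exponent_ge' (abs_nonneg _) hle hα.le hαβ
      _ ≤ ‖x - y‖ ^ α := by
          gcongr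
          exact abs_coord_sub_le x y r
      _ ≤ B * ‖x - y‖ ^ α := le_mul_of_one_le_left (by positivity) hB

theorem iteratedFDeriv_clm_succ {E : Type*} [NormedAddCommGroup E] [NormedSpace ℝ E]
    (L : E →L[ℝ] ℝ) (m : ℕ) (x : E) (v : Fin (m + 1) → E) :
    iteratedFDeriv ℝ (m + 1) L x v = if m = 0 then L (v 0) else 0 := by
  have hL : (fun y => fderiv ℝ L y) = fun _ => L := by
    ext y
    simp
  rw [iteratedFDeriv_succ_apply_right, hL]
  rcases m with _ | m
  · simp
  · rw [iteratedFDeriv_succ_const]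
    simp

theorem coord_mem_holderBall {t : ℕ} {α B : ℝ} (hα : 0 < α) (hB : 1 ≤ B) (r : Fin t) :
    (fun x : EuclideanSpace ℝ (Fin t) => x r) ∈ HolderBall α B (cube t 0 1) := by
  rcases le_or_gt α 1 with hα1 | hα1
  · simpa using coord_rpow_mem_holderBall (β := 1) hα hα1 hα1 le_rfl hB r
  · set L : EuclideanSpace ℝ (Fin t) →L[ℝ] ℝ := EuclideanSpace.proj r
    have hL : (fun x : EuclideanSpace ℝ (Fin t) => x r) = L := rfl
    rw [hL]
    refine ⟨L.contDiff.contDiffOn, ?_, ?_⟩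
    · intro m _ J x hx
      rcases m with _ | m
      · rw [mixedPartial_zero]
        change |x r| ≤ B
        rw [abs_of_nonneg (hx r).1]
        exact (hx r).2.trans hB
      · rw [mixedPartial_cube L.contDiff zero_lt_one J hx, iteratedFDeriv_clm_succ]
        split_ifs
        · change |(EuclideanSpace.single (J 0) (1 : ℝ)) r| ≤ B
          rw [PiLp.single_apply]
          split_ifs <;> simp <;> linarith
        · simp
          linarith
    · intro J x hx y hy _
      -- The top-order derivative has order at least `1`, hence is constant for a linear map, and
      -- the Hölder quotient vanishes.
      have hq := strictFloor_pos_of_one_lt hα1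
      rw [mixedPartial_cube L.contDiff zero_lt_one J hx,
        mixedPartial_cube L.contDiff zero_lt_one J hy]
      revert J
      rw [← Nat.succ_pred_eq_of_pos hq]
      intro J
      rw [iteratedFDeriv_clm_succ, iteratedFDeriv_clm_succ, sub_self, abs_zero, zero_div]
      linarith

theorem coord_rpow_min_mem_holderBall {t : ℕ} {α B : ℝ} (hα : 0 < α) (hB : 1 ≤ B) (r : Fin t) :
    (fun x : EuclideanSpace ℝ (Fin t) => x r ^ min α 1) ∈ HolderBall α B (cube t 0 1) := by
  rcases le_total α 1 with hα1 | hα1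
  · rw [min_eq_left hα1]
    exact coord_rpow_mem_holderBall hα hα1 le_rfl hα1 hB r
  · rw [min_eq_right hα1]
    simpa using coord_mem_holderBall hα hB r

/-! ### Sums of localized bumps -/

/-- A smooth bump at the centre of the unit cube, supported in its interior. -/
noncomputable def unitBump (t : ℕ) :
    ContDiffBump (WithLp.toLp 2 fun _ => 1 / 2 : EuclideanSpace ℝ (Fin t)) where
  rIn := 1 / 4
  rOut := 1 / 3
  rIn_pos := by norm_num
  rIn_lt_rOut := by norm_num

/-- The lower corner of the `u`-th unit cell. -/
noncomputable def corner {t m : ℕ} (u : Fin t → Fin m) : EuclideanSpace ℝ (Fin t) :=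
  WithLp.toLp 2 fun j => ((u j : ℕ) : ℝ)

/-- The bump function rescaled to the `u`-th cell of the regular grid of mesh `1 / m`. -/
noncomputable def cellBump {t m : ℕ} (u : Fin t → Fin m) (x : EuclideanSpace ℝ (Fin t)) : ℝ :=
  unitBump t ((m : ℝ) • x - corner u)

/-- The perturbation `∑ θ_u m^{-α} K(m x - u)`. -/
noncomputable def bumpSum {t m : ℕ} (α : ℝ) (θ : (Fin t → Fin m) → Bool)
    (x : EuclideanSpace ℝ (Fin t)) : ℝ :=
  (m : ℝ) ^ (-α) * ∑ u, (if θ u then 1 else 0) * cellBump u x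

theorem mem_cell_of_mem_tsupport {t m : ℕ} {u : Fin t → Fin m} {x : EuclideanSpace ℝ (Fin t)}
    (h : (m : ℝ) • x - corner u ∈ tsupport (unitBump t)) (j : Fin t) :
    (u j : ℕ) < m * x j ∧ m * x j < (u j : ℕ) + 1 := by
  rw [ContDiffBump.tsupport_eq, Metric.mem_closedBall, dist_eq_norm] at h
  have h1 := (PiLp.norm_apply_le _ j).trans h
  simp only [corner, PiLp.sub_apply, PiLp.smul_apply, smul_eq_mul, Real.norm_eq_abs] at h1
  have h2 : (unitBump t).rOut = 1 / 3 := rfl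
  rw [h2, abs_le] at h1
  constructor <;> linarith [h1.1, h1.2]

/-- The outer radius `1/3` is below `1/2`, so closed supports lie in open, disjoint cells. Closed
supports are used because derivatives of every order vanish off them. -/
theorem eq_of_mem_tsupport {t m : ℕ} {u v : Fin t → Fin m} {x : EuclideanSpace ℝ (Fin t)}
    (hu : (m : ℝ) • x - corner u ∈ tsupport (unitBump t))
    (hv : (m : ℝ) • x - corner v ∈ tsupport (unitBump t)) : u = v := by
  ext j
  have h1 := mem_cell_of_mem_tsupport hu j
  have h2 := mem_cell_of_mem_tsupport hv j
  have h3 : ((u j : ℕ) : ℝ) < ((v j : ℕ) + 1 : ℕ) := by push_cast; linarith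
  have h4 : ((v j : ℕ) : ℝ) < ((u j : ℕ) + 1 : ℕ) := by push_cast; linarith
  have h5 : (u j : ℕ) < (v j : ℕ) + 1 := by exact_mod_cast h3
  have h6 : (v j : ℕ) < (u j : ℕ) + 1 := by exact_mod_cast h4
  omega

theorem mem_tsupport_of_cellBump_ne_zero {t m : ℕ} {u : Fin t → Fin m}
    {x : EuclideanSpace ℝ (Fin t)} (h : cellBump u x ≠ 0) :
    (m : ℝ) • x - corner u ∈ tsupport (unitBump t) :=
  subset_tsupport _ h

theorem cellBump_nonneg {t m : ℕ} (u : Fin t → Fin m) (x : EuclideanSpace ℝ (Fin t)) :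
    0 ≤ cellBump u x := (unitBump t).nonneg

theorem cellBump_le_one {t m : ℕ} (u : Fin t → Fin m) (x : EuclideanSpace ℝ (Fin t)) :
    cellBump u x ≤ 1 := (unitBump t).le_one

theorem cellBump_eq_one {t m : ℕ} {u : Fin t → Fin m} {x : EuclideanSpace ℝ (Fin t)}
    (ht : 1 ≤ t) (h : ∀ j, |m * x j - (u j : ℕ) - 1 / 2| ≤ 1 / (4 * t)) : cellBump u x = 1 := by
  apply ContDiffBump.one_of_mem_closedBall
  have ht0 : (1 : ℝ) ≤ t := by exact_mod_cast ht
  have h2 : (unitBump t).rIn = 1 / 4 := rfl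
  rw [Metric.mem_closedBall, dist_eq_norm, h2, EuclideanSpace.norm_eq]
  refine Real.sqrt_le_iff.2 ⟨by norm_num, ?_⟩
  -- A box of half-side `1 / (4t)` fits in the ball of radius `1/4`, since `√t / (4t) ≤ 1/4`.
  calc ∑ j, ‖((m : ℝ) • x - corner u - WithLp.toLp 2 fun _ => 1 / 2 : EuclideanSpace ℝ (Fin t)) j‖ ^ 2
      ≤ ∑ _j : Fin t, (1 / (4 * (t : ℝ))) ^ 2 := by
        refine Finset.sum_le_sum fun j _ => pow_le_pow_left₀ (norm_nonneg _) ?_ 2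
        simpa [corner] using h j
    _ = 1 / 16 * (1 / t) := by
        rw [Finset.sum_const, Finset.card_univ, Fintype.card_fin, nsmul_eq_mul]
        field_simp
        norm_num
    _ ≤ 1 / 16 * 1 := by
        gcongr
        rw [div_le_one (by linarith)]
        exact ht0
    _ = (1 / 4) ^ 2 := by norm_num

theorem bumpSum_eq_single {t m : ℕ} (α : ℝ) (θ : (Fin t → Fin m) → Bool) {u : Fin t → Fin m}
    {x : EuclideanSpace ℝ (Fin t)} (h : cellBump u x ≠ 0) :
    bumpSum α θ x = if θ u then (m : ℝ) ^ (-α) * cellBump u x else 0 := by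
  rw [bumpSum, Finset.sum_eq_single u]
  · split_ifs <;> simp
  · intro v _ hv
    rw [mul_eq_zero]
    right
    by_contra hne
    exact hv (eq_of_mem_tsupport (mem_tsupport_of_cellBump_ne_zero hne)
      (mem_tsupport_of_cellBump_ne_zero h))
  · simp

theorem bumpSum_mem_Icc {t m : ℕ} (α : ℝ) (θ : (Fin t → Fin m) → Bool)
    (x : EuclideanSpace ℝ (Fin t)) : bumpSum α θ x ∈ Set.Icc 0 ((m : ℝ) ^ (-α)) := by
  have hm : 0 ≤ (m : ℝ) ^ (-α) := by positivity
  by_cases h : ∃ u : Fin t → Fin m, cellBump u x ≠ 0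
  · obtain ⟨u, hu⟩ := h
    rw [bumpSum_eq_single α θ hu]
    split_ifs
    · exact ⟨mul_nonneg hm (cellBump_nonneg u x), mul_le_of_le_one_right hm (cellBump_le_one u x)⟩
    · exact ⟨le_rfl, hm⟩
  · push Not at h
    simp [bumpSum, h, hm]

theorem bumpSum_flipAt {t m : ℕ} (α : ℝ) (θ : (Fin t → Fin m) → Bool) {u : Fin t → Fin m}
    {x : EuclideanSpace ℝ (Fin t)} (h : cellBump u x = 0) :
    bumpSum α (flipAt u θ) x = bumpSum α θ x := by
  unfold bumpSum
  congr 1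
  refine Finset.sum_congr rfl fun v _ => ?_
  by_cases hv : v = u
  · subst hv
    simp [h]
  · simp [flipAt, Function.update_of_ne hv]

theorem contDiff_cellBump {t m : ℕ} (u : Fin t → Fin m) {n : ℕ} :
    ContDiff ℝ n (cellBump u) :=
  (unitBump t).contDiff.comp ((contDiff_id.const_smul (m : ℝ)).sub contDiff_const)

theorem contDiff_bumpSum {t m : ℕ} (α : ℝ) (θ : (Fin t → Fin m) → Bool) {n : ℕ} :
    ContDiff ℝ n (bumpSum α θ) :=
  contDiff_const.mul (ContDiff.sum fun u _ => contDiff_const.mul (contDiff_cellBump u))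

theorem iteratedFDeriv_cellBump {t m : ℕ} (u : Fin t → Fin m) (s : ℕ)
    (x : EuclideanSpace ℝ (Fin t)) :
    iteratedFDeriv ℝ s (cellBump u) x =
      (m : ℝ) ^ s • iteratedFDeriv ℝ s (unitBump t) ((m : ℝ) • x - corner u) := by
  have h : cellBump u = fun z => (fun y => unitBump t (y - corner u)) ((m : ℝ) • z) := rfl
  have hc : ContDiff ℝ s fun y => unitBump t (y - corner u) :=
    (unitBump t).contDiff.comp (contDiff_id.sub contDiff_const)
  rw [h, iteratedFDeriv_comp_const_smul _ hc]
  simp only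
  rw [iteratedFDeriv_comp_sub]

theorem mixedPartial_bumpSum {t m : ℕ} (α : ℝ) (θ : (Fin t → Fin m) → Bool) {s : ℕ}
    (J : Fin s → Fin t) {x : EuclideanSpace ℝ (Fin t)} (hx : x ∈ cube t 0 1) :
    mixedPartial (bumpSum α θ) (cube t 0 1) J x =
      (m : ℝ) ^ (-α) * (m : ℝ) ^ s * ∑ u, (if θ u then 1 else 0) *
        iteratedFDeriv ℝ s (unitBump t) ((m : ℝ) • x - corner u)
          (fun r => EuclideanSpace.single (J r) (1 : ℝ)) := by
  rw [mixedPartial_cube (contDiff_bumpSum α θ) zero_lt_one J hx]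
  have h1 : bumpSum α θ = fun x => (m : ℝ) ^ (-α) • ∑ u, ((if θ u then 1 else 0 : ℝ) • cellBump u x) := rfl
  rw [h1, iteratedFDeriv_const_smul_apply'
    (ContDiff.sum fun u _ => (contDiff_cellBump u).const_smul _).contDiffAt,
    iteratedFDeriv_fun_sum_apply fun u _ => ((contDiff_cellBump u).const_smul _).contDiffAt]
  simp_rw [iteratedFDeriv_const_smul_apply' (contDiff_cellBump _).contDiffAt,
    iteratedFDeriv_cellBump]
  simp only [smul_apply, sum_apply, smul_eq_mul]
  rw [mul_assoc, Finset.mul_sum (a := (m : ℝ) ^ s)]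
  congr 1
  refine Finset.sum_congr rfl fun u _ => ?_
  ring

theorem exists_bound_iteratedFDeriv_unitBump (t N : ℕ) : ∃ C : ℝ, 1 ≤ C ∧
    ∀ s ≤ N, ∀ z, ‖iteratedFDeriv ℝ s (unitBump t) z‖ ≤ C := by
  have h : ∀ s : ℕ, ∃ C : ℝ, ∀ z, ‖iteratedFDeriv ℝ s (unitBump t) z‖ ≤ C := fun s =>
    (((unitBump t).contDiff (n := s)).continuous_iteratedFDeriv le_rfl).bounded_above_of_compact_support
      ((unitBump t).hasCompactSupport.iteratedFDeriv s)
  choose C hC using h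
  have hC0 : ∀ s, 0 ≤ C s := fun s => (norm_nonneg _).trans (hC s 0)
  refine ⟨1 + ∑ s ∈ Finset.range (N + 1), C s, ?_, fun s hs z => ?_⟩
  · linarith [Finset.sum_nonneg fun s (_ : s ∈ Finset.range (N + 1)) => hC0 s]
  · have := Finset.single_le_sum (fun s _ => hC0 s) (Finset.mem_range.2 (Nat.lt_succ_of_le hs))
    linarith [hC s z]

theorem norm_iteratedFDeriv_unitBump_sub_le {t s : ℕ} {C : ℝ}
    (hC : ∀ z, ‖iteratedFDeriv ℝ (s + 1) (unitBump t) z‖ ≤ C) (y z : EuclideanSpace ℝ (Fin t)) :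
    ‖iteratedFDeriv ℝ s (unitBump t) y - iteratedFDeriv ℝ s (unitBump t) z‖ ≤ C * ‖y - z‖ := by
  refine Convex.norm_image_sub_le_of_norm_fderiv_le (𝕜 := ℝ) (s := Set.univ) (fun x _ => ?_)
    (fun x _ => ?_) convex_univ (Set.mem_univ z) (Set.mem_univ y)
  · exact ((unitBump t).contDiff (n := (s + 1 : ℕ))).differentiable_iteratedFDeriv
      (by exact_mod_cast Nat.lt_succ_self s) x
  · rw [norm_fderiv_iteratedFDeriv]
    exact hC x

theorem abs_apply_single_le {t s : ℕ} (M : ContinuousMultilinearMap ℝ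
    (fun _ : Fin s => EuclideanSpace ℝ (Fin t)) ℝ) (J : Fin s → Fin t) :
    |M fun r => EuclideanSpace.single (J r) (1 : ℝ)| ≤ ‖M‖ := by
  simpa using M.le_opNorm fun r => EuclideanSpace.single (J r) (1 : ℝ)

theorem abs_sum_le_card_mul {ι : Type*} [Fintype ι] {a : ι → ℝ} {D : ℝ} (s : Finset ι)
    (hs : ∀ u, a u ≠ 0 → u ∈ s) (h : ∀ u, |a u| ≤ D) : |∑ u, a u| ≤ s.card * D := by
  rw [← Finset.sum_subset (Finset.subset_univ s) fun u _ hu => by_contra fun h => hu (hs u h)]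
  refine (Finset.abs_sum_le_sum_abs _ _).trans ?_
  rw [← nsmul_eq_mul]
  exact Finset.sum_le_card_nsmul s _ _ fun u _ => h u

/-- Interpolates between the Lipschitz bound `z` and the trivial bound `2` on the increment of a
derivative. -/
theorem min_two_le_rpow {γ z : ℝ} (hγ : 0 ≤ γ) (hγ1 : γ ≤ 1) (hz : 0 ≤ z) :
    min z 2 ≤ 2 * z ^ γ := by
  rcases le_total z 1 with h | h
  · have h1 : z ≤ z ^ γ := by
      simpa using Real.rpow_le_rpow_of_exponent_ge' hz h hγ hγ1
    have h2 : 0 ≤ z ^ γ := Real.rpow_nonneg hz _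
    exact (min_le_left _ _).trans (by linarith)
  · exact (min_le_right _ _).trans (by linarith [Real.one_le_rpow h hγ])

/-- A derivative of order `s` scales as `m^{s-α} ≤ 1`, and at top order `m^{q-α} (m‖x-y‖)^{α-q} =
‖x-y‖^{α-q}`, so the constant depends on neither `m` nor `θ`. In `4 * C`, one factor `2` comes from
the at most two cells active at `x` or `y`, the other from `min_two_le_rpow`. -/
theorem bumpSum_mem_holderBall (t : ℕ) {α : ℝ} (hα : 0 < α) : ∃ C : ℝ, 1 ≤ C ∧
    ∀ B, C ≤ B → ∀ m : ℕ, 1 ≤ m → ∀ θ : (Fin t → Fin m) → Bool,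
      bumpSum α θ ∈ HolderBall α B (cube t 0 1) := by
  classical
  set q := strictFloor α with hq
  obtain ⟨C, hC1, hC⟩ := exists_bound_iteratedFDeriv_unitBump t (q + 1)
  refine ⟨4 * C, by linarith, fun B hB m hm θ => ?_⟩
  have hm1 : (1 : ℝ) ≤ m := by exact_mod_cast hm
  have hm0 : (0 : ℝ) < m := by linarith
  have hqα : (q : ℝ) < α := strictFloor_lt hα
  have hqα1 : α ≤ q + 1 := le_strictFloor_add_one α
  set S : EuclideanSpace ℝ (Fin t) → Finset (Fin t → Fin m) := fun x =>
    Finset.univ.filter fun u => (m : ℝ) • x - corner u ∈ tsupport (unitBump t) with hS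
  have hScard : ∀ x, (S x).card ≤ 1 := fun x => Finset.card_le_one.2 fun u hu v hv =>
    eq_of_mem_tsupport (Finset.mem_filter.1 hu).2 (Finset.mem_filter.1 hv).2
  have hS0 : ∀ (s : ℕ) (x : EuclideanSpace ℝ (Fin t)) (u : Fin t → Fin m), u ∉ S x →
      iteratedFDeriv ℝ s (unitBump t) ((m : ℝ) • x - corner u) = 0 := by
    intro s x u hu
    by_contra hne
    exact hu (Finset.mem_filter.2 ⟨Finset.mem_univ _, support_iteratedFDeriv_subset s hne⟩)
  refine ⟨(contDiff_bumpSum α θ).contDiffOn, ?_, ?_⟩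
  · intro s hs J x hx
    rw [mixedPartial_bumpSum α θ J hx, abs_mul, abs_of_nonneg (by positivity)]
    have h1 : (m : ℝ) ^ (-α) * (m : ℝ) ^ s ≤ 1 := by
      rw [← Real.rpow_natCast, ← Real.rpow_add hm0]
      refine Real.rpow_le_one_of_one_le_of_nonpos hm1 ?_
      have : (s : ℝ) ≤ q := by exact_mod_cast hs
      linarith
    have h2 := abs_sum_le_card_mul (D := C)
      (a := fun u => (if θ u then (1 : ℝ) else 0) *
        iteratedFDeriv ℝ s (unitBump t) ((m : ℝ) • x - corner u)
          (fun r => EuclideanSpace.single (J r) (1 : ℝ))) (S x)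
      (fun u hu => by
        by_contra hne
        simp [hS0 s x u hne] at hu)
      (fun u => by
        have h3 := (abs_apply_single_le
          (iteratedFDeriv ℝ s (unitBump t) ((m : ℝ) • x - corner u)) J).trans
          (hC s (by omega) _)
        split_ifs
        · simpa using h3
        · simp
          linarith)
    have h4 : ((S x).card : ℝ) ≤ 1 := by exact_mod_cast hScard x
    calc _ ≤ 1 * (((S x).card : ℝ) * C) := by gcongr
      _ ≤ 1 * (1 * C) := by gcongr
      _ ≤ B := by linarith
  · intro J x hx y hy hxy
    have hn : 0 < ‖x - y‖ := norm_pos_iff.2 (sub_ne_zero.2 hxy)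
    set γ := α - (q : ℝ) with hγ
    rw [mixedPartial_bumpSum α θ J hx, mixedPartial_bumpSum α θ J hy, ← mul_sub,
      ← Finset.sum_sub_distrib, abs_mul, abs_of_nonneg (by positivity),
      div_le_iff₀ (by positivity)]
    have h2 := abs_sum_le_card_mul (D := C * (2 * (m * ‖x - y‖) ^ γ))
      (a := fun u => (if θ u then (1 : ℝ) else 0) *
        iteratedFDeriv ℝ q (unitBump t) ((m : ℝ) • x - corner u)
          (fun r => EuclideanSpace.single (J r) (1 : ℝ)) - (if θ u then (1 : ℝ) else 0) *
        iteratedFDeriv ℝ q (unitBump t) ((m : ℝ) • y - corner u)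
          (fun r => EuclideanSpace.single (J r) (1 : ℝ))) (S x ∪ S y)
      (fun u hu => by
        by_contra hne
        rw [Finset.mem_union, not_or] at hne
        simp [hS0 q x u hne.1, hS0 q y u hne.2] at hu)
      (fun u => by
        rw [← mul_sub, ← sub_apply, abs_mul]
        set M := iteratedFDeriv ℝ q (unitBump t) ((m : ℝ) • x - corner u) -
          iteratedFDeriv ℝ q (unitBump t) ((m : ℝ) • y - corner u)
        have hM1 : ‖M‖ ≤ C * (m * ‖x - y‖) := by
          refine (norm_iteratedFDeriv_unitBump_sub_le (hC (q + 1) le_rfl) _ _).trans (le_of_eq ?_)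
          rw [sub_sub_sub_cancel_right, ← smul_sub, norm_smul, Real.norm_of_nonneg hm0.le]
        have hM2 : ‖M‖ ≤ C * 2 := by
          refine (norm_sub_le _ _).trans ?_
          linarith [hC q (by omega) ((m : ℝ) • x - corner u),
            hC q (by omega) ((m : ℝ) • y - corner u)]
        have hM3 : ‖M‖ ≤ C * (2 * (m * ‖x - y‖) ^ γ) := by
          calc ‖M‖ ≤ C * min (m * ‖x - y‖) 2 := by
                rcases min_choice (m * ‖x - y‖) 2 with h | h <;> rw [h] <;> assumption
            _ ≤ _ := by
                gcongr
                exact min_two_le_rpow (by linarith) (by linarith) (by positivity)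
        have h3 : |(if θ u then (1 : ℝ) else 0)| ≤ 1 := by split_ifs <;> simp
        calc _ ≤ 1 * ‖M‖ := by
              gcongr
              exact abs_apply_single_le M J
          _ ≤ _ := by rw [one_mul]; exact hM3)
    have h4 : ((S x ∪ S y).card : ℝ) ≤ 2 := by
      exact_mod_cast (Finset.card_union_le _ _).trans (by linarith [hScard x, hScard y])
    have h5 : (m : ℝ) ^ (-α) * (m : ℝ) ^ q * (m : ℝ) ^ γ = 1 := by
      rw [← Real.rpow_natCast, ← Real.rpow_add hm0, ← Real.rpow_add hm0,
        show -α + (q : ℝ) + γ = 0 by rw [hγ]; ring, Real.rpow_zero]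
    calc _ ≤ (m : ℝ) ^ (-α) * (m : ℝ) ^ q * (2 * (C * (2 * (m * ‖x - y‖) ^ γ))) := by
          gcongr
          exact h2.trans (by gcongr)
      _ = ((m : ℝ) ^ (-α) * (m : ℝ) ^ q * (m : ℝ) ^ γ) * (4 * C * ‖x - y‖ ^ γ) := by
          rw [Real.mul_rpow hm0.le hn.le]
          ring
      _ ≤ B * ‖x - y‖ ^ γ := by
          rw [h5, one_mul]
          gcongr

/-! ### Perturbed compositions -/

/-- The index `j`, replaced by the last index if it is out of range. -/
def clampIdx {d : ℕ} (hd : 1 ≤ d) (j : ℕ) : Fin d := ⟨min j (d - 1), by omega⟩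

theorem clampIdx_eq {d : ℕ} (hd : 1 ≤ d) {j : ℕ} (hj : j < d) : clampIdx hd j = ⟨j, hj⟩ := by
  ext
  simp only [clampIdx]
  omega

/-- The first `t` coordinates. -/
noncomputable def head (t : ℕ) {d : ℕ} (hd : 1 ≤ d) (x : EuclideanSpace ℝ (Fin d)) :
    EuclideanSpace ℝ (Fin t) :=
  WithLp.toLp 2 fun r => x (clampIdx hd r)

/-- The class asks for an injective choice of `t` coordinates even if a component uses a single one;
a transposition puts that one first. -/
theorem exists_embedding_apply_zero {t d : ℕ} (ht : 1 ≤ t) (htd : t ≤ d) (j : Fin d) :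
    ∃ s : Fin t ↪ Fin d, s ⟨0, ht⟩ = j :=
  ⟨(Fin.castLEEmb htd).trans (Equiv.swap (Fin.castLE htd ⟨0, ht⟩) j).toEmbedding, by simp⟩

section

variable {k : ℕ} {d : Fin (k + 2) → ℕ} (hd : ∀ i, 1 ≤ d i) (t : Fin (k + 1) → ℕ)
  (α : Fin (k + 1) → ℝ) (i : Fin (k + 1)) {m : ℕ} (θ : (Fin (t i) → Fin m) → Bool)

/-- The layers of a perturbed composition: they pass the first coordinates on to layer `i`, which
applies the bump function, and the later layers take powers. -/
noncomputable def bumpLayer (l : Fin (k + 1)) (x : EuclideanSpace ℝ (Fin (d l.castSucc))) :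
    EuclideanSpace ℝ (Fin (d l.succ)) :=
  WithLp.toLp 2 fun j =>
    if l < i then x (clampIdx (hd _) j)
    else if l = i then bumpSum (α i) θ (head (t i) (hd _) x)
    else x (clampIdx (hd _) 0) ^ min (α l) 1

theorem composeLayers_succ (f : ∀ i : Fin (k + 1),
    EuclideanSpace ℝ (Fin (d i.castSucc)) → EuclideanSpace ℝ (Fin (d i.succ)))
    (l : Fin (k + 1)) (x : EuclideanSpace ℝ (Fin (d 0))) :
    composeLayers d f l.succ x = f l (composeLayers d f l.castSucc x) := rfl

/-- Every layer up to `i` has width at least `t i`, so clamping never alters the first `t i`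
coordinates. -/
theorem composeLayers_bumpLayer_of_le (htd : ∀ l, l ≤ i → t i ≤ d l.castSucc)
    (x : EuclideanSpace ℝ (Fin (d 0))) (idx : Fin (k + 2)) (hidx : idx ≤ i.castSucc) (r : ℕ)
    (hr : r < t i) :
    composeLayers d (bumpLayer hd t α i θ) idx x (clampIdx (hd _) r) = x (clampIdx (hd _) r) := by
  induction idx using Fin.induction generalizing r with
  | zero => rfl
  | succ l ih =>
    have hl : l < i := Fin.castSucc_lt_castSucc_iff.1 (l.castSucc_lt_succ.trans_le hidx)
    have hl1 : r < d l.succ := by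
      have h1 : (l : ℕ) + 1 < k + 1 := by
        have : (l : ℕ) < i := hl
        omega
      have h2 := htd ⟨l + 1, h1⟩ (by
        have : (l : ℕ) < i := hl
        exact Fin.le_def.2 (by simpa using this))
      exact hr.trans_le h2
    rw [composeLayers_succ, clampIdx_eq (hd l.succ) hl1]
    simp only [bumpLayer, if_pos hl]
    exact ih (l.castSucc_lt_succ.le.trans hidx) r hr

theorem composeLayers_bumpLayer_of_lt (htd : ∀ l, l ≤ i → t i ≤ d l.castSucc)
    (x : EuclideanSpace ℝ (Fin (d 0))) (idx : Fin (k + 2)) (hidx : i.castSucc < idx)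
    (j : Fin (d idx)) :
    composeLayers d (bumpLayer hd t α i θ) idx x j =
      bumpSum (α i) θ (head (t i) (hd 0) x) ^
        ∏ l with i < l ∧ l.castSucc < idx, min (α l) 1 := by
  induction idx using Fin.induction with
  | zero => exact absurd hidx (by simp)
  | succ l ih =>
    have hil : i ≤ l := Fin.castSucc_lt_succ_iff.1 hidx
    rw [composeLayers_succ]
    rcases hil.eq_or_lt with rfl | hil
    · have hempty : (Finset.univ.filter fun l' : Fin (k + 1) => i < l' ∧ l'.castSucc < i.succ) =
          ∅ := by
        refine Finset.filter_eq_empty_iff.2 fun l' _ h => ?_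
        exact absurd h.1 (not_lt.2 (Fin.castSucc_lt_succ_iff.1 h.2))
      rw [hempty, Finset.prod_empty, Real.rpow_one]
      simp only [bumpLayer, lt_irrefl, if_false, if_true]
      congr 1
      ext r
      exact composeLayers_bumpLayer_of_le hd t α i θ htd x i.castSucc le_rfl r r.2
    · have hins : (Finset.univ.filter fun l' : Fin (k + 1) => i < l' ∧ l'.castSucc < l.succ) =
          insert l (Finset.univ.filter fun l' : Fin (k + 1) =>
            i < l' ∧ l'.castSucc < l.castSucc) := by
        ext l'
        simp only [Finset.mem_filter, Finset.mem_univ, true_and, Finset.mem_insert,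
          Fin.castSucc_lt_succ_iff, Fin.castSucc_lt_castSucc_iff]
        constructor
        · rintro ⟨h1, h2⟩
          exact h2.eq_or_lt.imp id fun h => ⟨h1, h⟩
        · rintro (rfl | ⟨h1, h2⟩)
          · exact ⟨hil, le_rfl⟩
          · exact ⟨h1, h2.le⟩
      rw [hins, Finset.prod_insert (by simp)]
      simp only [bumpLayer, if_neg (not_lt.2 hil.le), if_neg hil.ne']
      -- Exponents multiply because the base is nonnegative.
      rw [ih (Fin.castSucc_lt_castSucc_iff.2 hil), mul_comm,
        Real.rpow_mul (bumpSum_mem_Icc _ _ _).1]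

/-- The exponent of the perturbed compositions. -/
noncomputable def tailExponent : ℝ := ∏ l ∈ Finset.Ioi i, min (α l) 1

theorem continuous_head (t : ℕ) {d : ℕ} (hd : 1 ≤ d) : Continuous (head t hd) := by
  unfold head
  fun_prop

/-- The perturbed composition. -/
noncomputable def bumpFun : RegFun (d 0) :=
  ⟨fun w => bumpSum (α i) θ (head (t i) (hd 0) w.1) ^ tailExponent α i,
    ((((contDiff_bumpSum (n := 0) (α i) θ).continuous.comp
      (continuous_head (t i) (hd 0))).comp continuous_subtype_val).measurable).pow_const _⟩

theorem bumpSum_mem_Icc_zero_one (hm : 1 ≤ m) (hα : ∀ i, 0 < α i)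
    (x : EuclideanSpace ℝ (Fin (t i))) : bumpSum (α i) θ x ∈ Set.Icc 0 1 := by
  have h := bumpSum_mem_Icc (α i) θ x
  exact ⟨h.1, h.2.trans (Real.rpow_le_one_of_one_le_of_nonpos (by exact_mod_cast hm)
    (by linarith [hα i]))⟩

theorem bumpFun_mem_compositeClass (ht : ∀ i, 1 ≤ t i)
    (htd : ∀ j l : Fin (k + 1), l ≤ j → t j ≤ d l.castSucc) (hα : ∀ i, 0 < α i) {B : ℝ}
    (hB : 1 ≤ B) (hm : 1 ≤ m) (hbump : bumpSum (α i) θ ∈ HolderBall (α i) B (cube (t i) 0 1)) :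
    bumpFun hd t α i θ ∈ compositeClass k d t α B := by
  refine ⟨fun _ => 0, fun _ => 1, bumpLayer hd t α i θ, rfl, rfl, fun _ => ?_, fun l => ?_,
    fun l j => ?_, fun w j => ?_⟩
  · exact ⟨zero_lt_one, by simp; linarith, by simpa using hB⟩
  · intro x hx j
    simp only [bumpLayer]
    split_ifs
    · exact hx _
    · exact bumpSum_mem_Icc_zero_one t α i θ hm hα _
    · exact ⟨Real.rpow_nonneg (hx _).1 _, Real.rpow_le_one (hx _).1 (hx _).2
        (le_min (hα l).le zero_le_one)⟩
  · rcases lt_trichotomy l i with hl | rfl | hl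
    · obtain ⟨s, hs⟩ := exists_embedding_apply_zero (ht l) (htd l l le_rfl)
        (clampIdx (hd l.castSucc) j)
      refine ⟨s, _, coord_mem_holderBall (hα l) hB ⟨0, ht l⟩, fun x _ => ?_⟩
      simp [bumpLayer, hl, hs]
    · refine ⟨Fin.castLEEmb (htd l l le_rfl), _, hbump, fun x _ => ?_⟩
      simp only [bumpLayer, lt_irrefl, if_false, if_true]
      congr 1
      ext r
      simp only [head]
      rw [clampIdx_eq (hd _) (r.2.trans_le (htd l l le_rfl))]
      rfl
    · obtain ⟨s, hs⟩ := exists_embedding_apply_zero (ht l) (htd l l le_rfl)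
        (clampIdx (hd l.castSucc) 0)
      refine ⟨s, _, coord_rpow_min_mem_holderBall (hα l) hB ⟨0, ht l⟩, fun x _ => ?_⟩
      simp [bumpLayer, not_lt.2 hl.le, hl.ne', hs]
  · rw [composeLayers_bumpLayer_of_lt hd t α i θ (fun l hl => htd i l hl) w.1 (Fin.last (k + 1))
      (Fin.castSucc_lt_last i) j]
    simp only [bumpFun, tailExponent]
    congr 1
    refine Finset.prod_congr ?_ fun _ _ => rfl
    ext l
    simp [Fin.castSucc_lt_last]

end

/-! ### Volumes of cylinders over boxes -/

theorem uniformCube_pi {d : ℕ} (I : Fin d → Set ℝ) (hI : ∀ j, MeasurableSet (I j))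
    (hI01 : ∀ j, I j ⊆ Set.Icc 0 1) :
    uniformCube d {w | ∀ j, w.1 j ∈ I j} = ∏ j, volume (I j) := by
  have h1 : (Subtype.val '' {w : Covariate d | ∀ j, w.1 j ∈ I j}) =
      (WithLp.ofLp : EuclideanSpace ℝ (Fin d) → Fin d → ℝ) ⁻¹' (Set.univ.pi I) := by
    ext x
    simp only [Set.mem_image, Set.mem_preimage, Set.mem_univ_pi, Set.mem_ofPred_eq]
    constructor
    · rintro ⟨w, hw, rfl⟩
      exact hw
    · intro h
      exact ⟨⟨x, fun j => hI01 j (h j)⟩, h, rfl⟩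
  rw [uniformCube, comap_subtype_coe_apply (measurableSet_cube d 0 1), h1,
    (PiLp.volume_preserving_ofLp (Fin d)).measure_preimage
      (MeasurableSet.univ_pi hI).nullMeasurableSet, volume_pi_pi]

/-- The cylinder over the box with lower corner `p` and side length `ρ`. -/
def boxCylinder (d : ℕ) {t : ℕ} (hd : 1 ≤ d) (p : Fin t → ℝ) (ρ : ℝ) : Set (Covariate d) :=
  {w | ∀ r : Fin t, head t hd w.1 r ∈ Set.Icc (p r) (p r + ρ)}

theorem measurableSet_boxCylinder {d t : ℕ} (hd : 1 ≤ d) (p : Fin t → ℝ) (ρ : ℝ) :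
    MeasurableSet (boxCylinder d hd p ρ) := by
  rw [boxCylinder, Set.ofPred_forall]
  refine MeasurableSet.iInter fun r => measurableSet_Icc.preimage ?_
  have hc : Continuous fun x : EuclideanSpace ℝ (Fin t) => x r := by fun_prop
  exact (hc.comp ((continuous_head t hd).comp continuous_subtype_val)).measurable

theorem uniformCube_boxCylinder {d t : ℕ} (hd : 1 ≤ d) (htd : t ≤ d) {p : Fin t → ℝ} {ρ : ℝ}
    (hp : ∀ r, 0 ≤ p r) (hp1 : ∀ r, p r + ρ ≤ 1) :
    uniformCube d (boxCylinder d hd p ρ) = ENNReal.ofReal ρ ^ t := by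
  have h1 : boxCylinder d hd p ρ = {w : Covariate d | ∀ j : Fin d, w.1 j ∈
      if h : (j : ℕ) < t then Set.Icc (p ⟨j, h⟩) (p ⟨j, h⟩ + ρ) else Set.Icc 0 1} := by
    ext w
    simp only [boxCylinder, head, Set.mem_ofPred_eq]
    constructor
    · intro h j
      split_ifs with hj
      · have h2 := h ⟨j, hj⟩
        rwa [clampIdx_eq hd j.2] at h2
      · exact w.2 j
    · intro h r
      have h2 := h ⟨r, r.2.trans_le htd⟩
      rw [dif_pos r.2] at h2
      rwa [clampIdx_eq hd (r.2.trans_le htd)]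
  rw [h1, uniformCube_pi]
  · have h2 : ∀ j : Fin d, volume (if h : (j : ℕ) < t then Set.Icc (p ⟨j, h⟩) (p ⟨j, h⟩ + ρ)
        else Set.Icc 0 1) = if (j : ℕ) < t then ENNReal.ofReal ρ else 1 := by
      intro j
      split_ifs <;> simp
    simp_rw [h2]
    -- The unconstrained coordinates contribute a factor `1`, leaving `t` factors `ρ`.
    rw [Finset.prod_ite]
    simp [Fin.card_filter_val_lt, htd]
  · intro j
    split_ifs <;> exact measurableSet_Icc
  · intro j
    split_ifs with h
    · exact Set.Icc_subset_Icc (hp _) (hp1 _)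
    · exact le_rfl

/-! ### Separation and closeness of the perturbed compositions -/

section

variable {k : ℕ} {d : Fin (k + 2) → ℕ} (hd : ∀ i, 1 ≤ d i) (t : Fin (k + 1) → ℕ)
  (α : Fin (k + 1) → ℝ) (i : Fin (k + 1)) {m : ℕ} (θ : (Fin (t i) → Fin m) → Bool)

theorem tailExponent_pos (hα : ∀ i, 0 < α i) : 0 < tailExponent α i :=
  Finset.prod_pos fun l _ => lt_min (hα l) zero_lt_one

/-- The amplification: the later layers turn the smoothness `α i` into the effective smoothness. -/
theorem rpow_tailExponent (m : ℕ) :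
    ((m : ℝ) ^ (-(α i))) ^ tailExponent α i = (m : ℝ) ^ (-(effSmooth α i)) := by
  rw [← Real.rpow_mul (Nat.cast_nonneg m), effSmooth, tailExponent, neg_mul]

theorem bumpFun_mem_Icc (hα : ∀ i, 0 < α i) (w : Covariate (d 0)) :
    (bumpFun hd t α i θ).1 w ∈ Set.Icc 0 ((m : ℝ) ^ (-(effSmooth α i))) := by
  have h := bumpSum_mem_Icc (α i) θ (head (t i) (hd 0) w.1)
  rw [← rpow_tailExponent]
  exact ⟨Real.rpow_nonneg h.1 _, Real.rpow_le_rpow h.1 h.2 (tailExponent_pos α i hα).le⟩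

/-- The cylinder over the `u`-th cell of the grid. -/
def cellCylinder (u : Fin (t i) → Fin m) : Set (Covariate (d 0)) :=
  boxCylinder (d 0) (hd 0) (fun r => ((u r : ℕ) : ℝ) / m) (1 / m)

/-- The cylinder over the central part of the `u`-th cell of the grid. -/
def coreCylinder (u : Fin (t i) → Fin m) : Set (Covariate (d 0)) :=
  boxCylinder (d 0) (hd 0) (fun r => (((u r : ℕ) : ℝ) + 1 / 2 - 1 / (4 * t i)) / m)
    (1 / (2 * t i * m))

theorem uniformCube_cellCylinder (htd : t i ≤ d 0) (hm : 1 ≤ m) (u : Fin (t i) → Fin m) :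
    uniformCube (d 0) (cellCylinder hd t i u) = ENNReal.ofReal (1 / m) ^ t i := by
  have hm0 : (0 : ℝ) < m := by exact_mod_cast hm
  refine uniformCube_boxCylinder (hd 0) htd (fun r => by positivity) fun r => ?_
  rw [← add_div, div_le_one hm0]
  exact_mod_cast (u r).2

theorem uniformCube_coreCylinder (ht : ∀ i, 1 ≤ t i) (htd : t i ≤ d 0) (hm : 1 ≤ m)
    (u : Fin (t i) → Fin m) :
    uniformCube (d 0) (coreCylinder hd t i u) = ENNReal.ofReal (1 / (2 * t i * m)) ^ t i := by
  have hm0 : (0 : ℝ) < m := by exact_mod_cast hm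
  have ht1 : (1 : ℝ) ≤ t i := by exact_mod_cast ht i
  have h4 : 1 / (4 * (t i : ℝ)) ≤ 1 / 4 := by
    rw [div_le_div_iff₀ (by positivity) (by norm_num)]
    linarith
  refine uniformCube_boxCylinder (hd 0) htd (fun r => ?_) fun r => ?_
  · have : (0 : ℝ) ≤ (u r : ℕ) := Nat.cast_nonneg _
    apply div_nonneg _ hm0.le
    linarith
  · have h1 : ((u r : ℕ) : ℝ) + 1 ≤ m := by exact_mod_cast (u r).2
    have h2 : 1 / (2 * (t i : ℝ) * m) = (2 * (1 / (4 * t i))) / m := by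
      field_simp
      norm_num
    rw [h2, ← add_div, div_le_one hm0]
    linarith

theorem mem_cellCylinder (hm : 1 ≤ m) {u : Fin (t i) → Fin m} {w : Covariate (d 0)}
    (h : cellBump u (head (t i) (hd 0) w.1) ≠ 0) : w ∈ cellCylinder hd t i u := by
  have hm0 : (0 : ℝ) < m := by exact_mod_cast hm
  intro r
  have h1 := mem_cell_of_mem_tsupport (mem_tsupport_of_cellBump_ne_zero h) r
  rw [← add_div]
  constructor
  · rw [div_le_iff₀ hm0]
    linarith [h1.1]
  · rw [le_div_iff₀ hm0]
    linarith [h1.2]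

theorem cellBump_of_mem_coreCylinder (ht : ∀ i, 1 ≤ t i) (hm : 1 ≤ m) {u : Fin (t i) → Fin m}
    {w : Covariate (d 0)} (h : w ∈ coreCylinder hd t i u) :
    cellBump u (head (t i) (hd 0) w.1) = 1 := by
  have hm0 : (0 : ℝ) < m := by exact_mod_cast hm
  have ht1 : (1 : ℝ) ≤ t i := by exact_mod_cast ht i
  refine cellBump_eq_one (ht i) fun r => ?_
  obtain ⟨h1, h2⟩ := h r
  have h3 : 1 / (2 * (t i : ℝ) * m) = (2 * (1 / (4 * t i))) / m := by
    field_simp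
    norm_num
  rw [h3, ← add_div, le_div_iff₀ hm0] at h2
  rw [div_le_iff₀ hm0] at h1
  rw [abs_le]
  constructor <;> linarith

theorem bumpFun_of_mem_coreCylinder (ht : ∀ i, 1 ≤ t i) (hα : ∀ i, 0 < α i) (hm : 1 ≤ m)
    {u : Fin (t i) → Fin m} {w : Covariate (d 0)} (h : w ∈ coreCylinder hd t i u) :
    (bumpFun hd t α i θ).1 w = if θ u then (m : ℝ) ^ (-(effSmooth α i)) else 0 := by
  have h1 := cellBump_of_mem_coreCylinder hd t i ht hm h
  change bumpSum (α i) θ (head (t i) (hd 0) w.1) ^ tailExponent α i = _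
  rw [bumpSum_eq_single (α i) θ (by rw [h1]; exact one_ne_zero), h1, mul_one]
  split_ifs
  · exact rpow_tailExponent α i m
  · exact Real.zero_rpow (tailExponent_pos α i hα).ne'

theorem bumpFun_flipAt (hm : 1 ≤ m) {u : Fin (t i) → Fin m} {w : Covariate (d 0)}
    (h : w ∉ cellCylinder hd t i u) :
    (bumpFun hd t α i (flipAt u θ)).1 w = (bumpFun hd t α i θ).1 w := by
  have h1 : cellBump u (head (t i) (hd 0) w.1) = 0 := by
    by_contra hne
    exact h (mem_cellCylinder hd t i hm hne)
  change bumpSum (α i) _ (head (t i) (hd 0) w.1) ^ _ = bumpSum (α i) _ _ ^ _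
  rw [bumpSum_flipAt (α i) θ h1]

theorem effSmooth_pos (hα : ∀ i, 0 < α i) : 0 < effSmooth α i :=
  mul_pos (hα i) (tailExponent_pos α i hα)

theorem rpow_neg_effSmooth_le_one (hα : ∀ i, 0 < α i) (hm : 1 ≤ m) :
    (m : ℝ) ^ (-(effSmooth α i)) ≤ 1 :=
  Real.rpow_le_one_of_one_le_of_nonpos (by exact_mod_cast hm)
    (by linarith [effSmooth_pos α i hα])

theorem sum_le_ellLoss_bumpFun (ht : ∀ i, 1 ≤ t i) (htd : t i ≤ d 0) (hα : ∀ i, 0 < α i)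
    (hm : 1 ≤ m) {σ : ℝ≥0} (hσ : 0 < σ) (θ η : (Fin (t i) → Fin m) → Bool) :
    ∑ u, (if θ u ≠ η u then
        ENNReal.ofReal (gaussianPDFReal 0 (σ ^ 2) 1 * (m : ℝ) ^ (-(effSmooth α i))) *
          ENNReal.ofReal (1 / (2 * t i * m)) ^ t i else 0) ≤
      ellLoss (gaussianCond σ (bumpFun hd t α i θ)) (gaussianCond σ (bumpFun hd t α i η)) := by
  set Δ := (m : ℝ) ^ (-(effSmooth α i)) with hΔ
  have hΔ0 : 0 ≤ Δ := by positivity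
  have hΔ1 : Δ ≤ 1 := rpow_neg_effSmooth_le_one α i hα hm
  set κ := ENNReal.ofReal (gaussianPDFReal 0 (σ ^ 2) 1 * Δ)
  have hcore : ∀ u : Fin (t i) → Fin m, MeasurableSet (coreCylinder hd t i u) := fun u =>
    measurableSet_boxCylinder _ _ _
  -- Cores of distinct cells are disjoint, so at each `w` at most one term survives; there the
  -- functions differ by exactly `Δ ≤ 1` if the bits differ.
  have hpoint : ∀ w, ∑ u, (coreCylinder hd t i u).indicator
      (fun _ => if θ u ≠ η u then κ else 0) w ≤
      tvDist (gaussianCond σ (bumpFun hd t α i θ) w) (gaussianCond σ (bumpFun hd t α i η) w) := by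
    intro w
    by_cases hw : ∃ u : Fin (t i) → Fin m, w ∈ coreCylinder hd t i u
    · obtain ⟨u, hu⟩ := hw
      rw [Finset.sum_eq_single u, Set.indicator_of_mem hu]
      · split_ifs with hne
        · have hdiff : |(bumpFun hd t α i θ).1 w - (bumpFun hd t α i η).1 w| = Δ := by
            rw [bumpFun_of_mem_coreCylinder hd t α i θ ht hα hm hu,
              bumpFun_of_mem_coreCylinder hd t α i η ht hα hm hu, ← hΔ]
            rcases hθ : θ u <;> rcases hη : η u <;> simp_all [abs_of_nonneg]
          have h := le_tvDist_gaussianReal (v := σ ^ 2) (by positivity) (hdiff.le.trans hΔ1)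
          rw [hdiff] at h
          exact h
        · exact zero_le
      · intro v _ hv
        refine Set.indicator_of_notMem (fun hmem => hv ?_) _
        have h1 := cellBump_of_mem_coreCylinder hd t i ht hm hu
        have h2 := cellBump_of_mem_coreCylinder hd t i ht hm hmem
        exact eq_of_mem_tsupport
          (mem_tsupport_of_cellBump_ne_zero (by rw [h2]; exact one_ne_zero))
          (mem_tsupport_of_cellBump_ne_zero (by rw [h1]; exact one_ne_zero))
      · simp
    · push Not at hw
      rw [Finset.sum_eq_zero fun u _ => Set.indicator_of_notMem (hw u) _]
      exact zero_le
  calc _ = ∫⁻ w, ∑ u, (coreCylinder hd t i u).indicator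
          (fun _ => if θ u ≠ η u then κ else 0) w ∂(uniformCube (d 0)) := by
        rw [lintegral_finsetSum _ fun u _ => measurable_const.indicator (hcore u)]
        refine Finset.sum_congr rfl fun u _ => ?_
        rw [lintegral_indicator_const (hcore u), uniformCube_coreCylinder hd t i ht htd hm]
        split_ifs
        · rfl
        · simp
    _ ≤ _ := lintegral_mono hpoint

/-- Makes the excess of the second moment over `1` linear in the squared difference of means,
uniformly on bounded ranges. -/
theorem exp_le_one_add_mul {a y : ℝ} (hy : 0 ≤ y) (hya : y ≤ a) :
    Real.exp y ≤ 1 + y * Real.exp a := by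
  have h1 : 1 - y ≤ Real.exp (-y) := by linarith [Real.add_one_le_exp (-y)]
  have h2 : (1 - y) * Real.exp y ≤ 1 := by
    calc (1 - y) * Real.exp y ≤ Real.exp (-y) * Real.exp y := by gcongr
      _ = 1 := by rw [← Real.exp_add]; simp
  have h3 : y * Real.exp y ≤ y * Real.exp a := by gcongr
  linarith

theorem chiSqDom_bumpFun (htd : t i ≤ d 0) (hα : ∀ i, 0 < α i) (hm : 1 ≤ m) {σ : ℝ≥0}
    (hσ : 0 < σ) (u : Fin (t i) → Fin m) :
    ChiSqDom (uniformCube (d 0) ⊗ₘ gaussianCond σ (bumpFun hd t α i θ))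
      (uniformCube (d 0) ⊗ₘ gaussianCond σ (bumpFun hd t α i (flipAt u θ)))
      (ENNReal.ofReal (1 + Real.exp (1 / σ ^ 2) / σ ^ 2 *
        (((m : ℝ) ^ (-(effSmooth α i))) ^ 2 * (1 / m) ^ t i))) := by
  have hv : σ ^ 2 ≠ 0 := by positivity
  have hσ0 : (0 : ℝ) < σ := by exact_mod_cast hσ
  set Δ := (m : ℝ) ^ (-(effSmooth α i)) with hΔ
  have hΔ0 : 0 ≤ Δ := by positivity
  have hΔ1 : Δ ≤ 1 := rpow_neg_effSmooth_le_one α i hα hm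
  set F := bumpFun hd t α i θ
  set F' := bumpFun hd t α i (flipAt u θ)
  have hmeas : Measurable fun w => ENNReal.ofReal
      (Real.exp ((F.1 w - F'.1 w) ^ 2 / ((σ ^ 2 : ℝ≥0) : ℝ))) :=
    ENNReal.measurable_ofReal.comp
      (Real.measurable_exp.comp (((F.2.sub F'.2).pow_const 2).div_const _))
  refine (ChiSqDom.compProd (μ := uniformCube (d 0)) hmeas
    fun w => chiSqDom_gaussianReal (F.1 w) (F'.1 w) hv).mono ?_
  have hcell : MeasurableSet (cellCylinder hd t i u) := measurableSet_boxCylinder _ _ _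
  set E := Real.exp (1 / (σ : ℝ) ^ 2) / σ ^ 2 * Δ ^ 2 with hE
  have hE0 : 0 ≤ E := by positivity
  -- Off the flipped cell the conditional laws coincide and the second moment is `1`; the excess is
  -- paid on the cell only.
  have hpoint : ∀ w, ENNReal.ofReal (Real.exp ((F.1 w - F'.1 w) ^ 2 / ((σ ^ 2 : ℝ≥0) : ℝ))) ≤
      1 + (cellCylinder hd t i u).indicator (fun _ => ENNReal.ofReal E) w := by
    intro w
    by_cases hw : w ∈ cellCylinder hd t i u
    · rw [Set.indicator_of_mem hw, ← ENNReal.ofReal_one, ← ENNReal.ofReal_add zero_le_one hE0]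
      apply ENNReal.ofReal_le_ofReal
      have h1 := bumpFun_mem_Icc hd t α i θ hα w
      have h2 := bumpFun_mem_Icc hd t α i (flipAt u θ) hα w
      have h3 : (F.1 w - F'.1 w) ^ 2 ≤ Δ ^ 2 := by
        apply sq_le_sq'
        · linarith [h1.1, h2.2]
        · linarith [h1.2, h2.1]
      have h4 : Δ ^ 2 ≤ 1 := pow_le_one₀ hΔ0 hΔ1
      push_cast
      have h5 : (F.1 w - F'.1 w) ^ 2 / (σ : ℝ) ^ 2 ≤ 1 / (σ : ℝ) ^ 2 := by
        gcongr
        exact h3.trans h4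
      refine (exp_le_one_add_mul (by positivity) h5).trans ?_
      rw [hE]
      calc 1 + (F.1 w - F'.1 w) ^ 2 / (σ : ℝ) ^ 2 * Real.exp (1 / (σ : ℝ) ^ 2)
          ≤ 1 + Δ ^ 2 / (σ : ℝ) ^ 2 * Real.exp (1 / (σ : ℝ) ^ 2) := by gcongr
        _ = _ := by ring
    · rw [Set.indicator_of_notMem hw, bumpFun_flipAt hd t α i θ hm hw]
      simp [F]
  refine (lintegral_mono hpoint).trans (le_of_eq ?_)
  rw [lintegral_add_left measurable_const, lintegral_indicator_const hcell,
    uniformCube_cellCylinder hd t i htd hm, lintegral_one, measure_univ,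
    ← ENNReal.ofReal_pow (by positivity), ← ENNReal.ofReal_mul hE0, ← ENNReal.ofReal_one,
    ← ENNReal.ofReal_add zero_le_one (by positivity)]
  congr 1
  rw [hE]
  ring

theorem one_add_div_pow_le_exp {C x : ℝ} {n : ℕ} (hn : 1 ≤ n) (hC : 0 ≤ C) (hx0 : 0 ≤ x)
    (hx : x ≤ 1 / n) : (1 + C * x) ^ n ≤ Real.exp C := by
  have hn0 : (0 : ℝ) < n := by exact_mod_cast hn
  calc (1 + C * x) ^ n ≤ Real.exp (C * x) ^ n := by
        gcongr
        linarith [Real.add_one_le_exp (C * x)]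
    _ = Real.exp (n * (C * x)) := (Real.exp_nat_mul _ _).symm
    _ ≤ Real.exp C := by
        apply Real.exp_le_exp.2
        calc n * (C * x) ≤ n * (C * (1 / n)) := by gcongr
          _ = C := by field_simp

/-- A mesh of the order of the optimal bandwidth. -/
theorem exists_mesh {β : ℝ} (hβ : 0 < β) {s : ℕ} {n : ℕ} (hn : 1 ≤ n) :
    ∃ m : ℕ, 1 ≤ m ∧ ((m : ℝ) ^ (-β)) ^ 2 * (1 / m) ^ s ≤ 1 / n ∧
      2 ^ (-β) * (n : ℝ) ^ (-(β / (2 * β + s))) ≤ (m : ℝ) ^ (-β) := by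
  have hn1 : (1 : ℝ) ≤ n := by exact_mod_cast hn
  have hn0 : (0 : ℝ) < n := by linarith
  have hs : (0 : ℝ) ≤ s := Nat.cast_nonneg s
  have he : 0 < 2 * β + s := by linarith
  set y := (n : ℝ) ^ (1 / (2 * β + s)) with hy
  have hy1 : 1 ≤ y := Real.one_le_rpow hn1 (by positivity)
  have hy0 : 0 < y := by linarith
  have hym : y ≤ ⌈y⌉₊ := Nat.le_ceil y
  -- Rounding up keeps `m ≥ y`, which controls the information; `m ≤ 2y`, valid as `y ≥ 1`, loses
  -- only `2^{-β}` in the height.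
  have hmy : (⌈y⌉₊ : ℝ) ≤ 2 * y := by linarith [Nat.ceil_lt_add_one hy0.le]
  have hm0 : (0 : ℝ) < ⌈y⌉₊ := by linarith
  refine ⟨⌈y⌉₊, Nat.one_le_ceil_iff.2 hy0, ?_, ?_⟩
  · have h1 : ((⌈y⌉₊ : ℝ) ^ (-β)) ^ 2 * (1 / (⌈y⌉₊ : ℝ)) ^ s = ((⌈y⌉₊ : ℝ) ^ (2 * β + s))⁻¹ := by
      rw [← Real.rpow_natCast _ 2, ← Real.rpow_mul hm0.le, one_div, inv_pow, ← Real.rpow_natCast _ s,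
        ← Real.rpow_neg hm0.le, ← Real.rpow_neg hm0.le, ← Real.rpow_add hm0]
      congr 1
      push_cast
      ring
    have h2 : (n : ℝ) = y ^ (2 * β + s) := by
      rw [hy, ← Real.rpow_mul hn0.le, one_div_mul_cancel he.ne', Real.rpow_one]
    rw [h1, one_div]
    apply inv_anti₀ hn0
    rw [h2]
    gcongr
  · have h1 : (n : ℝ) ^ (-(β / (2 * β + s))) = y ^ (-β) := by
      rw [hy, ← Real.rpow_mul hn0.le]
      congr 1
      ring
    rw [h1, ← Real.mul_rpow (by norm_num) hy0.le]
    exact Real.rpow_le_rpow_of_nonpos hm0 hmy (by linarith)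

/-- The lower bound contributed by a single layer. -/
theorem exists_le_minimaxRisk (hd : ∀ i, 1 ≤ d i) (ht : ∀ i, 1 ≤ t i)
    (htd : ∀ j l : Fin (k + 1), l ≤ j → t j ≤ d l.castSucc) (hα : ∀ i, 0 < α i) :
    ∃ B₀ : ℝ, 0 < B₀ ∧ ∀ B : ℝ, B₀ ≤ B → ∀ σ : ℝ≥0, 0 < σ → ∃ c : ℝ, 0 < c ∧ ∀ n : ℕ, 1 ≤ n →
      ENNReal.ofReal (c * (n : ℝ) ^ (-(effSmooth α i / (2 * effSmooth α i + (t i : ℝ))))) ≤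
        minimaxRisk σ n (compositeClass k d t α B) := by
  obtain ⟨B₀, hB₀, hbump⟩ := bumpSum_mem_holderBall (t i) (hα i)
  refine ⟨B₀, by linarith, fun B hB σ hσ => ?_⟩
  have hσ0 : (0 : ℝ) < σ := by exact_mod_cast hσ
  have ht0 : (0 : ℝ) < t i := by exact_mod_cast ht i
  have htd0 : t i ≤ d 0 := htd i 0 (Fin.zero_le _)
  set κ := gaussianPDFReal 0 (σ ^ 2) 1
  have hκ : 0 < κ := gaussianPDFReal_pos _ _ _ (by positivity)
  set C := Real.exp (1 / (σ : ℝ) ^ 2) / σ ^ 2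
  have hC : 0 ≤ C := by positivity
  set β := effSmooth α i
  have hβ : 0 < β := effSmooth_pos α i hα
  -- This is the bound of `assouad` with `R = exp C`, after the number `m^{t_i}` of cells cancels
  -- the factor `m^{-t_i}` in the core volume.
  set c₁ := 1 / (4 * Real.exp C) * (κ * (1 / (2 * (t i : ℝ))) ^ t i) / 4 with hc₁
  refine ⟨c₁ * 2 ^ (-β), by positivity, fun n hn => ?_⟩
  obtain ⟨m, hm, hmn, hrate⟩ := exists_mesh hβ (s := t i) hn
  have hm0 : (0 : ℝ) < m := by exact_mod_cast hm
  have hχ : ∀ (θ : (Fin (t i) → Fin m) → Bool) (u : Fin (t i) → Fin m),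
      ChiSqDom (sampleLaw σ n (bumpFun hd t α i θ))
        (sampleLaw σ n (bumpFun hd t α i (flipAt u θ))) (ENNReal.ofReal (Real.exp C)) := by
    intro θ u
    refine ((chiSqDom_bumpFun hd t α i θ htd0 hα hm hσ u).pi n).mono ?_
    rw [← ENNReal.ofReal_pow (by positivity)]
    exact ENNReal.ofReal_le_ofReal (one_add_div_pow_le_exp hn hC (by positivity) hmn)
  refine le_trans ?_ (assouad hσ n (bumpFun hd t α i)
    (fun θ => bumpFun_mem_compositeClass hd t α i θ ht htd hα (hB₀.trans hB) hm (hbump B hB m hm θ))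
    (sum_le_ellLoss_bumpFun hd t α i ht htd0 hα hm hσ) (Real.one_le_exp hC) hχ)
  have hcard : (Fintype.card (Fin (t i) → Fin m) : ℝ≥0∞) = ENNReal.ofReal ((m : ℝ) ^ t i) := by
    rw [ENNReal.ofReal_pow hm0.le, ENNReal.ofReal_natCast]
    simp
  rw [hcard, ← ENNReal.ofReal_pow (by positivity), ← ENNReal.ofReal_mul (by positivity),
    ← ENNReal.ofReal_mul (by positivity), ← ENNReal.ofReal_mul (by positivity),
    show (4 : ℝ≥0∞) = ENNReal.ofReal 4 by simp, ← ENNReal.ofReal_div_of_pos (by norm_num)]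
  apply ENNReal.ofReal_le_ofReal
  calc c₁ * 2 ^ (-β) * (n : ℝ) ^ (-(β / (2 * β + (t i : ℝ))))
      = c₁ * (2 ^ (-β) * (n : ℝ) ^ (-(β / (2 * β + (t i : ℝ))))) := by ring
    _ ≤ c₁ * (m : ℝ) ^ (-β) := by gcongr
    _ = _ := by
        rw [hc₁, show 1 / (2 * (t i : ℝ) * m) = 1 / (2 * (t i : ℝ)) * (1 / m) by field_simp,
          mul_pow, one_div_pow (m : ℝ)]
        have : (m : ℝ) ^ t i ≠ 0 := by positivity
        field_simp
        rfl

end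

end CompositeRegression

/-! ### Combining the layers -/

theorem theorem2 (k : ℕ) (hk : 1 ≤ k)
    (d : Fin (k + 2) → ℕ) (hd : ∀ i, 1 ≤ d i) (hd_last : d (Fin.last (k + 1)) = 1)
    (t : Fin (k + 1) → ℕ) (ht : ∀ i, 1 ≤ t i)
    (htd : ∀ j l : Fin (k + 1), l ≤ j → t j ≤ d l.castSucc)
    (α : Fin (k + 1) → ℝ) (hα : ∀ i, 0 < α i) :
    ∃ B₀ : ℝ, 0 < B₀ ∧ ∀ B : ℝ, B₀ ≤ B → ∀ σ : NNReal, 0 < σ →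
      ∃ c : ℝ, 0 < c ∧ ∀ n : ℕ, 1 ≤ n →
        ENNReal.ofReal (c * CompositeRegression.rate t α n) ≤
          CompositeRegression.minimaxRisk σ n
            (CompositeRegression.compositeClass k d t α B) := by
  choose B₀ hB₀ hmain using fun i =>
    CompositeRegression.exists_le_minimaxRisk t α i hd ht htd hα
  -- The largest radius and, below, the smallest constant serve all layers; the rate is then
  -- attained at a single layer `i`.
  refine ⟨Finset.univ.sup' Finset.univ_nonempty B₀, (Finset.lt_sup'_iff _).2
    ⟨0, Finset.mem_univ _, hB₀ 0⟩, fun B hB σ hσ => ?_⟩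
  choose c hc hrisk using fun i =>
    hmain i B ((Finset.le_sup' B₀ (Finset.mem_univ i)).trans hB) σ hσ
  refine ⟨Finset.univ.inf' Finset.univ_nonempty c, (Finset.lt_inf'_iff _).2 fun i _ => hc i,
    fun n hn => ?_⟩
  obtain ⟨i, -, hi⟩ := Finset.exists_mem_eq_sup' (Finset.univ_nonempty (α := Fin (k + 1)))
    fun i => (n : ℝ) ^ (-(CompositeRegression.effSmooth α i /
      (2 * CompositeRegression.effSmooth α i + (t i : ℝ))))
  refine le_trans (ENNReal.ofReal_le_ofReal ?_) (hrisk i n hn)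
  rw [CompositeRegression.rate, hi]
  gcongr
  exact Finset.inf'_le c (Finset.mem_univ i)
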